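/- Let $d\ge 1$, let $s\ge 1$ be an integer, let $\beta>-d$ and let $\lambda_0,\dots,\lambda_{s-1}>0$. Let $\mathbb V_0^{d+1}=\{(x,t)\in\mathbb R^d\times[0,1]:\|x\|=t\}$ be the conic surface, with measure $\int f\,d\mathsf m=\int_0^1 t^{d-1}\int_{\mathbb S^{d-1}}f(t\xi,t)\,d\sigma(\xi)\,dt$, let $\omega_d$ be the area of $\mathbb S^{d-1}$, and let $\mathsf w_{\beta,\gamma}(t)=t^\beta(1-t)^\gamma$. *Derivative.* On functions on $\mathbb V_0^{d+1}$, $\partial_t$ is the derivative in $t$ that treats solid harmonics as constants: $\partial_t[q(t)Y(x)]=q'(t)Y(x)$ for every homogeneous harmonic polynomial $Y$ on $\mathbb R^d$. In general, $G=\partial_tF$ means that for every $m\ge 0$ and every homogeneous harmonic polynomial $Y$ of degree $m$ the function $t\mapsto t^{-m}\frac1{\omega_d}\int_{\mathbb S^{d-1}}F(t\xi,t)Y(\xi)\,d\sigma(\xi)$ is locally absolutely continuous on $(0,1]$, with a.e. derivative the corresponding function for $G$. Here the derivatives $\partial_t^kf$ with $k<s$ are required to have restrictions in $L^2$ to every sphere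 $\{(t\xi,t):\xi\in\mathbb S^{d-1}\}$, $0<t\le1$, and $\partial_t^sf$ is required to be measurable and to have restrictions in $L^2$ to almost every such sphere. Let $W_2^s$ be the space of continuous $f$ on $\mathbb V_0^{d+1}$ that have derivatives $\partial_t^kf$, $k\le s$, in this sense, with $\partial_t^sf\in L^2(\mathbb V_0^{d+1},\mathsf w_{\beta+s,0})$. *Projections.* Put $$\langle f,g\rangle_{\beta,s}=b_{\beta,s}\int_{\mathbb V_0^{d+1}}fg\,\mathsf w_{\beta,s}\,d\mathsf m,\qquad b_{\beta,s}=\frac1{\omega_d}\,\frac{\Gamma(\beta+d+s+1)}{\Gamma(\beta+d)\Gamma(s+1)},$$ $$\langle f,g\rangle_{\beta,-s}=\frac1{\omega_d}\int_{\mathbb V_0^{d+1}}\partial_t^sf\,\partial_t^sg\,t^{\beta+s}\,d\mathsf m+\sum_{k=0}^{s-1}\frac{\lambda_k}{\omega_d}\int_{\mathbb S^{d-1}}\partial_t^kf(\xi,1)\,\partial_t^kg(\xi,1)\,d\sigma(\xi).$$ For $n\ge 0$ let $\mathcal V_n^d(\mathsf w_{\beta,\pm s})$ be the space of polynomials of degree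 at most $n$ on $\mathbb V_0^{d+1}$ that are orthogonal, with respect to $\langle\cdot,\cdot\rangle_{\beta,\pm s}$, to all polynomials of degree less than $n$, and let $\operatorname{proj}_n^{\beta,\pm s}$ be the orthogonal projection onto it; put $\operatorname{proj}_n^{\beta,s}=0$ for $n<0$. **Theorem.** Let $f\in W_2^s$ and $g\in L^2(\mathbb V_0^{d+1},\mathsf w_{\beta,s})$ satisfy $f(x,t)=(1-t)^sg(x,t)$ on $\mathbb V_0^{d+1}$, where $f$ vanishes to order $s$ at the rim $t=1$ in the sense that $\int_{\mathbb S^{d-1}}|(1-t)g(t\xi,t)|^2\,d\sigma(\xi)\to0$ as $t\to1^-$ (which holds, for example, whenever $g$ is bounded near the rim). Then for every $n\ge0$ the projections $\operatorname{proj}_n^{\beta,-s}f$ and $\operatorname{proj}_n^{\beta,s}g$ exist and are unique, and $$\operatorname{proj}_n^{\beta,-s}f=(1-t)^s\operatorname{proj}_{n-s}^{\beta,s}g\quad\text{on }\mathbb V_0^{d+1};$$ in particular $\operatorname{proj}_n^{\beta,-s}f=0$ for $n<s$. -/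

import Mathlib

open MeasureTheory Filter Topology

noncomputable section

/-- The conic surface `{(x, t) ∈ ℝ^d × ℝ : ‖x‖ = t, 0 ≤ t ≤ 1}`. -/
abbrev ConeSurface (d : ℕ) : Type :=
  {p : EuclideanSpace ℝ (Fin d) × ℝ // ‖p.1‖ = p.2 ∧ 0 ≤ p.2 ∧ p.2 ≤ 1}

/-- The unit sphere of `ℝ^d`. -/
abbrev UnitSphere (d : ℕ) : Type := Metric.sphere (0 : EuclideanSpace ℝ (Fin d)) 1

/-- The surface (Lebesgue) measure `dσ` of the unit sphere. -/
def sphereMeasure (d : ℕ) : Measure (UnitSphere d) :=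
  (volume : Measure (EuclideanSpace ℝ (Fin d))).toSphere

/-- The surface area `ω_d` of the unit sphere. -/
def sphereArea (d : ℕ) : ℝ := (sphereMeasure d).real Set.univ

/-- The point `(t ξ, t)` of the conic surface, for `t ∈ [0, 1]` and `‖ξ‖ = 1`
(real numbers outside `[0, 1]` are first clamped to `[0, 1]`). -/
def conePoint {d : ℕ} (t : ℝ) (ξ : UnitSphere d) : ConeSurface d :=
  ⟨((max 0 (min t 1)) • (ξ : EuclideanSpace ℝ (Fin d)), max 0 (min t 1)), by
    have h0 : (0 : ℝ) ≤ max 0 (min t 1) := le_max_left _ _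
    have h1 : max 0 (min t 1) ≤ (1 : ℝ) := max_le zero_le_one (min_le_right _ _)
    have hξ : ‖(ξ : EuclideanSpace ℝ (Fin d))‖ = 1 := by simp
    refine ⟨?_, h0, h1⟩
    simp only [norm_smul, hξ, mul_one, Real.norm_eq_abs]
    exact abs_of_nonneg h0⟩

theorem conePoint_val {d : ℕ} {t : ℝ} (h0 : 0 ≤ t) (h1 : t ≤ 1) (ξ : UnitSphere d) :
    (conePoint t ξ).1 = (t • (ξ : EuclideanSpace ℝ (Fin d)), t) := by
  simp [conePoint, min_eq_left h1, max_eq_right h0]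

theorem continuous_conePoint (d : ℕ) :
    Continuous (fun p : ℝ × UnitSphere d => conePoint p.1 p.2) := by
  unfold conePoint
  fun_prop

/-- The measure `dm` of the conic surface:
`∫ f dm = ∫_0^1 t^(d-1) ∫_{S^(d-1)} f(tξ, t) dσ(ξ) dt`. -/
def coneMeasure (d : ℕ) : Measure (ConeSurface d) :=
  ((((volume : Measure ℝ).restrict (Set.Ioc 0 1)).withDensity
      (fun t => ENNReal.ofReal (t ^ (d - 1)))).prod (sphereMeasure d)).map
    (fun p : ℝ × UnitSphere d => conePoint p.1 p.2)

/-- The measure `w_{β,γ}(t) dm` with `w_{β,γ}(t) = t^β (1-t)^γ`. -/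
def weightedConeMeasure (d : ℕ) (β γ : ℝ) : Measure (ConeSurface d) :=
  (coneMeasure d).withDensity
    (fun p => ENNReal.ofReal (p.1.2 ^ β * (1 - p.1.2) ^ γ))

/-- The normalization constant `b_{β,γ}`. -/
def coneNormConst (d : ℕ) (β γ : ℝ) : ℝ :=
  (1 / sphereArea d) *
    (Real.Gamma (β + d + γ + 1) / (Real.Gamma (β + d) * Real.Gamma (γ + 1)))

/-- The inner product `⟨f, g⟩_{β,γ} = b_{β,γ} ∫ f g w_{β,γ} dm`. -/
def coneInner {d : ℕ} (β γ : ℝ) (f g : ConeSurface d → ℝ) : ℝ :=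
  coneNormConst d β γ * ∫ p, f p * g p ∂(weightedConeMeasure d β γ)

/-- `Y` is a solid harmonic of degree `m`: a homogeneous polynomial of degree `m` in `d`
variables with `Δ Y = 0`. -/
def IsSolidHarmonic {d : ℕ} (m : ℕ) (Y : MvPolynomial (Fin d) ℝ) : Prop :=
  Y.IsHomogeneous m ∧ ∑ i : Fin d, MvPolynomial.pderiv i (MvPolynomial.pderiv i Y) = 0

/-- The coefficient function `t ↦ t^(-m) (1/ω_d) ∫ F(tξ, t) Y(ξ) dσ(ξ)`, where `Y` is a solid
harmonic of degree `m`. If `F(x,t) = ∑ q_{j,ℓ}(t) Y_{j,ℓ}(x)` with `Y_{j,ℓ}` an orthonormal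
family of solid harmonics of degree `j`, then the coefficient for `Y_{m,ℓ}` is `q_{m,ℓ}(t)`. -/
def harmonicCoeff {d : ℕ} (F : ConeSurface d → ℝ) (m : ℕ) (Y : MvPolynomial (Fin d) ℝ)
    (t : ℝ) : ℝ :=
  (t ^ m)⁻¹ * ((1 / sphereArea d) * ∫ ξ : UnitSphere d,
    F (conePoint t ξ) * MvPolynomial.eval (fun i => (ξ : EuclideanSpace ℝ (Fin d)) i) Y
      ∂(sphereMeasure d))

/-- `G = ∂_t F` on the conic surface. The derivative `∂_t` is the one for which solid harmonics
`Y(x)` are constants, `∂_t [q(t) Y(x)] = q'(t) Y(x)`: every coefficient function of `F` is locally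
absolutely continuous on `(0, 1]` and its derivative is the coefficient function of `G`. -/
def IsTDeriv {d : ℕ} (F G : ConeSurface d → ℝ) : Prop :=
  ∀ (m : ℕ) (Y : MvPolynomial (Fin d) ℝ), IsSolidHarmonic m Y →
    ∀ t ∈ Set.Ioc (0 : ℝ) 1,
      IntervalIntegrable (harmonicCoeff G m Y) volume t 1 ∧
      harmonicCoeff F m Y 1 - harmonicCoeff F m Y t = ∫ v in t..1, harmonicCoeff G m Y v

/-- `F 0, F 1, …, F s` are successive derivatives `∂_t^k (F 0)`. Those of order `k < s` have traces
in `L²` of every sphere `{(tξ, t)}`, `0 < t ≤ 1`; the last one is a measurable function with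
traces in `L²` for almost every `t`. -/
structure IsTDerivChain {d : ℕ} (s : ℕ) (F : ℕ → ConeSurface d → ℝ) : Prop where
  slice : ∀ k < s, ∀ t ∈ Set.Ioc (0 : ℝ) 1,
    MemLp (fun ξ : UnitSphere d => F k (conePoint t ξ)) 2 (sphereMeasure d)
  meas_top : AEStronglyMeasurable (F s) (coneMeasure d)
  slice_top : ∀ᵐ t ∂((volume : Measure ℝ).restrict (Set.Ioc 0 1)),
    MemLp (fun ξ : UnitSphere d => F s (conePoint t ξ)) 2 (sphereMeasure d)
  deriv : ∀ k < s, IsTDeriv (F k) (F (k + 1))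

/-- `f` has derivatives `∂_t^k f` for `k ≤ s`. -/
def HasTDerivs {d : ℕ} (s : ℕ) (f : ConeSurface d → ℝ) : Prop :=
  ∃ F : ℕ → ConeSurface d → ℝ, F 0 = f ∧ IsTDerivChain s F

open Classical in
/-- The derivative `∂_t^k f`, `k ≤ s`, of a function with derivatives up to order `s`
(for `k < s` it is determined almost everywhere on each sphere `{(tξ, t)}`, in particular on the
rim `t = 1`; for `k = s` it is determined almost everywhere on the surface). -/
def tDeriv {d : ℕ} (s : ℕ) (f : ConeSurface d → ℝ) (k : ℕ) : ConeSurface d → ℝ :=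
  if h : HasTDerivs s f then h.choose k else 0

/-- The Sobolev space `W_2^s` for the weight `w_{β+s,0}`. -/
def MemConeSobolev {d : ℕ} (β : ℝ) (s : ℕ) (f : ConeSurface d → ℝ) : Prop :=
  Continuous f ∧ HasTDerivs s f ∧
    MemLp (tDeriv s f s) 2 (weightedConeMeasure d (β + s) 0)

/-- The Sobolev inner product
`⟨f, g⟩_{β,-s} = (1/ω_d) ∫ ∂_t^s f ∂_t^s g t^(β+s) dm
  + ∑_{k<s} (lam_k/ω_d) ∫_{S^(d-1)} ∂_t^k f(ξ,1) ∂_t^k g(ξ,1) dσ(ξ)`. -/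
def coneSobolevInner {d : ℕ} (β : ℝ) (s : ℕ) (lam : ℕ → ℝ) (f g : ConeSurface d → ℝ) : ℝ :=
  (1 / sphereArea d) *
      ∫ p, tDeriv s f s p * tDeriv s g s p ∂(weightedConeMeasure d (β + s) 0) +
    ∑ k ∈ Finset.range s, (lam k / sphereArea d) *
      ∫ ξ : UnitSphere d, tDeriv s f k (conePoint 1 ξ) * tDeriv s g k (conePoint 1 ξ)
        ∂(sphereMeasure d)

/-- `q` is the restriction to the conic surface of a polynomial in `(x, t)` of total degree at
most `n`. -/
def IsConePoly {d : ℕ} (n : ℕ) (q : ConeSurface d → ℝ) : Prop :=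
  ∃ P : MvPolynomial (Fin d ⊕ Unit) ℝ, P.totalDegree ≤ n ∧
    ∀ p : ConeSurface d,
      q p = MvPolynomial.eval (Sum.elim (fun i => p.1.1 i) (fun _ => p.1.2)) P

/-- The orthogonal polynomials of degree `n` for the bilinear form `ip`: polynomials of degree at
most `n` on the conic surface that are orthogonal to all polynomials of lower degree. -/
def orthPolys {d : ℕ} (ip : (ConeSurface d → ℝ) → (ConeSurface d → ℝ) → ℝ) (n : ℕ) :
    Set (ConeSurface d → ℝ) :=
  {q | IsConePoly n q ∧ ∀ m < n, ∀ r : ConeSurface d → ℝ, IsConePoly m r → ip q r = 0}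

/-- `p` is the orthogonal projection of `f` onto `V` with respect to `ip`. -/
def IsOrthProj {d : ℕ} (ip : (ConeSurface d → ℝ) → (ConeSurface d → ℝ) → ℝ)
    (V : Set (ConeSurface d → ℝ)) (f p : ConeSurface d → ℝ) : Prop :=
  p ∈ V ∧ ∀ v ∈ V, ip f v = ip p v

open Classical in
/-- The orthogonal projection of `f` onto `V` with respect to `ip`. -/
def orthProj {d : ℕ} (ip : (ConeSurface d → ℝ) → (ConeSurface d → ℝ) → ℝ)
    (V : Set (ConeSurface d → ℝ)) (f : ConeSurface d → ℝ) : ConeSurface d → ℝ :=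
  if h : ∃ p, IsOrthProj ip V f p then h.choose else 0

/-- The space `V_n(w_{β,γ})` of orthogonal polynomials of degree `n`. -/
def coneV (d : ℕ) (β γ : ℝ) (n : ℕ) : Set (ConeSurface d → ℝ) :=
  orthPolys (coneInner β γ) n

/-- The space `V_n(w_{β,-s})` of Sobolev orthogonal polynomials of degree `n`. -/
def coneSobolevV (d : ℕ) (β : ℝ) (s : ℕ) (lam : ℕ → ℝ) (n : ℕ) : Set (ConeSurface d → ℝ) :=
  orthPolys (coneSobolevInner β s lam) n

/-- The projection `proj_n^{β,γ}`. -/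
def coneProj {d : ℕ} (β γ : ℝ) (n : ℕ) (g : ConeSurface d → ℝ) : ConeSurface d → ℝ :=
  orthProj (coneInner β γ) (coneV d β γ n) g

/-- The Sobolev projection `proj_n^{β,-s}`. -/
def coneSobolevProj {d : ℕ} (β : ℝ) (s : ℕ) (lam : ℕ → ℝ) (n : ℕ) (f : ConeSurface d → ℝ) :
    ConeSurface d → ℝ :=
  orthProj (coneSobolevInner β s lam) (coneSobolevV d β s lam n) f

end

/- The theorem is a duality: the Sobolev form pairs `f = (1 - t) ^ s * g` with a polynomial `v` of
degree `n` as the form `⟨·,·⟩_{β,s}` pairs `g` with a polynomial `w` of degree `n - s`, and pairs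
them to zero if `n < s`. The polynomials on the cone are spanned by the functions `t ^ k * Y(x)`
with `Y` a solid harmonic, and for `v = t ^ k * Y(x)` only the radial coefficient `φ` of `f` at `Y`
matters. Since `f` vanishes to order `s` at the rim, so do the rim terms, and `s` integrations by
parts turn the integral of `φ^(s)` against `t ^ (r + s)` into a multiple of the integral of `φ`
against `t ^ r`; so `w` is a multiple of `t ^ (k - s) * Y(x)`.

Applied to `(1 - t) ^ s * q` for polynomials `q`, the duality shows that multiplication by
`(1 - t) ^ s` maps orthogonal polynomials of degree `n - s` to Sobolev orthogonal polynomials of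
degree `n`, and that `v ↦ w` maps the latter back into the former; the projections of `g` and `f`
correspond. They exist and are unique because both forms are definite on polynomials. For the
Sobolev form this rests on the derivatives being well defined: a function all of whose harmonic
coefficients vanish is zero, as the solid harmonics are dense in `L²` of the sphere. -/

noncomputable section

section Laplacian

open MvPolynomial

variable {σ R : Type*} [Fintype σ] [CommSemiring R]

/-- The Laplacian `∑ i, ∂²/∂xᵢ²` as a linear operator on polynomials; its kernel on homogeneous
polynomials consists of the solid harmonics. -/
def polyLaplacian (σ R : Type*) [Fintype σ] [CommSemiring R] :
    MvPolynomial σ R →ₗ[R] MvPolynomial σ R :=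
  ∑ i : σ, (pderiv i).toLinearMap ∘ₗ (pderiv i).toLinearMap

/-- The polynomial `∑ i, xᵢ²`, whose powers carry the radial part of a polynomial. -/
def polyNormSq (σ R : Type*) [Fintype σ] [CommSemiring R] : MvPolynomial σ R :=
  ∑ i : σ, X i ^ 2

theorem polyLaplacian_apply (P : MvPolynomial σ R) :
    polyLaplacian σ R P = ∑ i : σ, pderiv i (pderiv i P) := by
  simp [polyLaplacian]

theorem isHomogeneous_polyNormSq : (polyNormSq σ R).IsHomogeneous 2 :=
  IsHomogeneous.sum _ _ _ fun i _ => by simpa using (isHomogeneous_X R i).pow 2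

theorem pderiv_polyNormSq (i : σ) : pderiv i (polyNormSq σ R) = 2 * X i := by
  classical
  simp [polyNormSq, pderiv_X, Pi.single_apply]

theorem polyLaplacian_polyNormSq_mul {n : ℕ} {Q : MvPolynomial σ R} (hQ : Q.IsHomogeneous n) :
    polyLaplacian σ R (polyNormSq σ R * Q) =
      polyNormSq σ R * polyLaplacian σ R Q + (4 * n + 2 * Fintype.card σ : R) • Q := by
  have pderiv_pderiv (i : σ) : pderiv i (pderiv i (polyNormSq σ R * Q)) =
      polyNormSq σ R * pderiv i (pderiv i Q) + 4 * (X i * pderiv i Q) + 2 * Q := by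
    have pderiv_two : pderiv i (2 : MvPolynomial σ R) = 0 := by
      rw [← map_ofNat (C : R →+* MvPolynomial σ R) 2, pderiv_C]
    simp only [pderiv_mul, map_add, pderiv_polyNormSq, pderiv_X_self, pderiv_two]
    ring
  simp only [polyLaplacian_apply, pderiv_pderiv, Finset.sum_add_distrib, ← Finset.mul_sum,
    hQ.sum_X_mul_pderiv, Finset.sum_const, Finset.card_univ, MvPolynomial.smul_eq_C_mul,
    map_add, map_mul, map_natCast, map_ofNat, nsmul_eq_mul]
  ring

theorem polyLaplacian_polyNormSq_pow_mul {m : ℕ} {Y : MvPolynomial σ R} (hY : Y.IsHomogeneous m)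
    (hΔ : polyLaplacian σ R Y = 0) (j : ℕ) :
    polyLaplacian σ R (polyNormSq σ R ^ (j + 1) * Y) =
      (2 * (j + 1) * (2 * j + 2 * m + Fintype.card σ) : R) • (polyNormSq σ R ^ j * Y) := by
  induction j with
  | zero =>
    rw [zero_add, pow_one, polyLaplacian_polyNormSq_mul hY, hΔ, mul_zero, zero_add, pow_zero,
      one_mul]
    congr 1
    push_cast
    ring
  | succ j ih =>
    rw [pow_succ' _ (j + 1), mul_assoc,
      polyLaplacian_polyNormSq_mul ((isHomogeneous_polyNormSq.pow (j + 1)).mul hY), ih,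
      mul_smul_comm, ← mul_assoc, ← pow_succ', ← add_smul]
    congr 1
    push_cast
    ring

theorem polyLaplacian_pow_polyNormSq_pow_mul {m : ℕ} {Y : MvPolynomial σ R}
    (hY : Y.IsHomogeneous m) (hΔ : polyLaplacian σ R Y = 0) (j : ℕ) :
    (polyLaplacian σ R ^ j) (polyNormSq σ R ^ j * Y) =
      (∏ i ∈ Finset.range j, (2 * (i + 1) * (2 * i + 2 * m + Fintype.card σ) : R)) • Y := by
  induction j with
  | zero => simp
  | succ j ih =>
    rw [pow_succ, Module.End.mul_apply, polyLaplacian_polyNormSq_pow_mul hY hΔ, map_smul, ih,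
      smul_smul, Finset.prod_range_succ, mul_comm]

theorem isHomogeneous_polyLaplacian {n : ℕ} {P : MvPolynomial σ R} (hP : P.IsHomogeneous n) :
    (polyLaplacian σ R P).IsHomogeneous (n - 2) := by
  rw [polyLaplacian_apply]
  exact IsHomogeneous.sum _ _ _ fun i _ => hP.pderiv.pderiv

theorem isHomogeneous_polyLaplacian_pow {n : ℕ} {P : MvPolynomial σ R} (hP : P.IsHomogeneous n)
    (k : ℕ) : ((polyLaplacian σ R ^ k) P).IsHomogeneous (n - 2 * k) := by
  induction k with
  | zero => simpa
  | succ k ih =>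
    rw [pow_succ', Module.End.mul_apply]
    exact isHomogeneous_polyLaplacian ih

theorem polyLaplacian_eq_zero_of_lt_two {n : ℕ} (hn : n < 2) {P : MvPolynomial σ R}
    (hP : P.IsHomogeneous n) : polyLaplacian σ R P = 0 := by
  rw [polyLaplacian_apply]
  refine Finset.sum_eq_zero fun i _ => ?_
  have pderiv_homogeneous : (pderiv i P).IsHomogeneous 0 := by
    simpa [show n - 1 = 0 by lia] using hP.pderiv (i := i)
  rw [← totalDegree_zero_iff_isHomogeneous, totalDegree_eq_zero_iff_eq_C] at pderiv_homogeneous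
  rw [pderiv_homogeneous, pderiv_C]

theorem polyLaplacian_pow_eq_zero {n k : ℕ} (hn : n < 2 * k) {P : MvPolynomial σ R}
    (hP : P.IsHomogeneous n) : (polyLaplacian σ R ^ k) P = 0 := by
  obtain ⟨k, rfl⟩ := Nat.exists_eq_succ_of_ne_zero (show k ≠ 0 by lia)
  rw [pow_succ', Module.End.mul_apply]
  exact polyLaplacian_eq_zero_of_lt_two (by lia) (isHomogeneous_polyLaplacian_pow hP k)

end Laplacian

section FischerDecomposition

open MvPolynomial

variable {σ K : Type*} [Fintype σ] [Field K]

/-- The homogeneous polynomials `‖x‖^(2 j) Y(x)` of degree `n` with `Y` a homogeneous harmonic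
polynomial, i.e. the terms of the Fischer decomposition in degree `n`. -/
def fischerTerms (σ K : Type*) [Fintype σ] [Field K] (n : ℕ) : Set (MvPolynomial σ K) :=
  {Q | ∃ j m Y, 2 * j + m = n ∧ Y.IsHomogeneous m ∧ polyLaplacian σ K Y = 0 ∧
    Q = polyNormSq σ K ^ j * Y}

theorem isHomogeneous_of_mem_fischerTerms {n : ℕ} {Q : MvPolynomial σ K}
    (hQ : Q ∈ fischerTerms σ K n) : Q.IsHomogeneous n := by
  obtain ⟨j, m, Y, rfl, hY, -, rfl⟩ := hQ
  exact (isHomogeneous_polyNormSq.pow j).mul hY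

variable [CharZero K] [Nonempty σ]

/- The top iterate `Y = Δᵏ P` is harmonic, and `Δᵏ (‖x‖^(2k) Y)` is a nonzero multiple of `Y`:
subtracting a multiple of `‖x‖^(2k) Y` from `P` lowers the order of the iterate that kills it. -/
theorem mem_span_fischerTerms_of_polyLaplacian_pow_eq_zero {n k : ℕ} {P : MvPolynomial σ K}
    (hP : P.IsHomogeneous n) (hk : (polyLaplacian σ K ^ k) P = 0) :
    P ∈ Submodule.span K (fischerTerms σ K n) := by
  induction k generalizing P with
  | zero => simp_all
  | succ k ih =>
    by_cases hn : n < 2 * k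
    · exact ih hP (polyLaplacian_pow_eq_zero hn hP)
    set Y := (polyLaplacian σ K ^ k) P with hYdef
    have hY : Y.IsHomogeneous (n - 2 * k) := isHomogeneous_polyLaplacian_pow hP k
    have hΔ : polyLaplacian σ K Y = 0 := by
      rw [hYdef, ← Module.End.mul_apply, ← pow_succ', hk]
    have hterm : polyNormSq σ K ^ k * Y ∈ fischerTerms σ K n :=
      ⟨k, _, Y, by lia, hY, hΔ, rfl⟩
    obtain ⟨c, hc, hcY⟩ : ∃ c : K, c ≠ 0 ∧
        (polyLaplacian σ K ^ k) (polyNormSq σ K ^ k * Y) = c • Y := by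
      refine ⟨_, Finset.prod_ne_zero_iff.2 fun i _ => ?_,
        polyLaplacian_pow_polyNormSq_pow_mul hY hΔ k⟩
      have := Fintype.card_ne_zero (α := σ)
      exact_mod_cast (by positivity :
        2 * (i + 1) * (2 * i + 2 * (n - 2 * k) + Fintype.card σ) ≠ 0)
    have hrest := ih (P := P - c⁻¹ • (polyNormSq σ K ^ k * Y))
      (hP.sub ((homogeneousSubmodule σ K n).smul_mem _ (isHomogeneous_of_mem_fischerTerms hterm)))
      (by rw [map_sub, map_smul, hcY, inv_smul_smul₀ hc, sub_self])
    simpa using add_mem hrest (Submodule.smul_mem _ c⁻¹ (Submodule.subset_span hterm))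

theorem mem_span_fischerTerms {n : ℕ} {P : MvPolynomial σ K} (hP : P.IsHomogeneous n) :
    P ∈ Submodule.span K (fischerTerms σ K n) :=
  mem_span_fischerTerms_of_polyLaplacian_pow_eq_zero hP
    (polyLaplacian_pow_eq_zero (k := n + 1) (by lia) hP)

end FischerDecomposition

section PolarCoordinates

open MvPolynomial

theorem eval_const_mul_of_isHomogeneous {σ R : Type*} [CommSemiring R] {n : ℕ}
    {P : MvPolynomial σ R} (hP : P.IsHomogeneous n) (r : R) (x : σ → R) :
    eval (fun i => r * x i) P = r ^ n * eval x P := by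
  rw [eval_eq, eval_eq, Finset.mul_sum]
  refine Finset.sum_congr rfl fun a ha => ?_
  have degree_eq : ∑ i ∈ a.support, a i = n := by
    rw [← hP (mem_support_iff.1 ha), Finsupp.weight_apply, Finsupp.sum]
    simp
  simp only [mul_pow, Finset.prod_mul_distrib, Finset.prod_pow_eq_pow_sum, degree_eq]
  ring

theorem integral_eq_integral_sphere_mul_integral_Ioi {E : Type*} [NormedAddCommGroup E]
    [NormedSpace ℝ E] [FiniteDimensional ℝ E] [Nontrivial E] [MeasurableSpace E] [BorelSpace E]
    (μ : Measure E) [μ.IsAddHaarMeasure] {F : E → ℝ} {q : Metric.sphere (0 : E) 1 → ℝ} {h : ℝ → ℝ}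
    (hF : ∀ r : ℝ, 0 < r → ∀ ξ : Metric.sphere (0 : E) 1, F (r • (ξ : E)) = q ξ * h r) :
    ∫ x, F x ∂μ = (∫ ξ, q ξ ∂μ.toSphere) *
      ∫ r in Set.Ioi (0 : ℝ), r ^ (Module.finrank ℝ E - 1) * h r := by
  have polar (x : ({0}ᶜ : Set E)) : F x = q (homeomorphUnitSphereProd E x).1 *
      h (homeomorphUnitSphereProd E x).2 := by
    rw [← hF _ (homeomorphUnitSphereProd E x).2.2]
    simp [smul_smul, norm_ne_zero_iff.2 x.2]
  calc ∫ x, F x ∂μ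
    _ = ∫ x : ({0}ᶜ : Set E), F x ∂(μ.comap (↑)) := by
        rw [integral_subtype_comap (measurableSet_singleton _).compl, restrict_compl_singleton]
    _ = ∫ z, q z.1 * h z.2 ∂μ.toSphere.prod (.volumeIoiPow (Module.finrank ℝ E - 1)) := by
        rw [← μ.measurePreserving_homeomorphUnitSphereProd.integral_comp
          (Homeomorph.measurableEmbedding _)]
        exact integral_congr_ae (.of_forall polar)
    _ = (∫ ξ, q ξ ∂μ.toSphere) *
          ∫ r : Set.Ioi (0 : ℝ), h r ∂(.volumeIoiPow (Module.finrank ℝ E - 1)) :=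
        integral_prod_mul q (fun r : Set.Ioi (0 : ℝ) => h r)
    _ = _ := by
        congr 1
        simp only [Measure.volumeIoiPow]
        rw [integral_withDensity_eq_integral_toReal_smul (by fun_prop) (by simp),
          ← integral_subtype_comap measurableSet_Ioi]
        refine integral_congr_ae (.of_forall fun r => ?_)
        simp [ENNReal.toReal_ofReal (pow_nonneg r.2.out.le _)]

end PolarCoordinates

section GaussianWeight

open MvPolynomial Real

variable {ι : Type*} [Fintype ι]

theorem eval_polyNormSq (x : EuclideanSpace ℝ ι) :
    eval (fun i => x i) (polyNormSq ι ℝ) = ‖x‖ ^ 2 := by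
  simp [polyNormSq, EuclideanSpace.norm_sq_eq]

theorem integrable_exp_neg_norm_sq_mul_eval (P : MvPolynomial ι ℝ) :
    Integrable fun x : EuclideanSpace ℝ ι => exp (-‖x‖ ^ 2) * eval (fun i => x i) P := by
  induction P using MvPolynomial.induction_on' with
  | monomial a c =>
    have factor (i : ι) : Integrable fun t : ℝ => t ^ a i * exp (-t ^ 2) := by
      simpa using integrable_rpow_mul_exp_neg_mul_sq one_pos
        (s := a i) (by linarith [(a i).cast_nonneg (α := ℝ)])
    have := ((EuclideanSpace.volume_preserving_symm_measurableEquiv_toLp ι).integrable_comp_emb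
      (MeasurableEquiv.measurableEmbedding _)).2 (Integrable.fintype_prod factor)
    refine (this.const_mul c).congr (.of_forall fun x => ?_)
    simp [EuclideanSpace.norm_sq_eq, Finset.prod_mul_distrib, ← exp_sum, eval_monomial,
      Finsupp.prod_fintype]
    ring
  | add P Q hP hQ => simpa only [map_add, mul_add] using hP.fun_add hQ

theorem hasLineDerivAt_eval {ι : Type*} [DecidableEq ι] (P : MvPolynomial ι ℝ)
    (x : EuclideanSpace ℝ ι) (i : ι) :
    HasLineDerivAt ℝ (fun x : EuclideanSpace ℝ ι => eval (fun i => x i) P)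
      (eval (fun i => x i) (pderiv i P)) x (EuclideanSpace.single i 1) := by
  unfold HasLineDerivAt
  induction P using MvPolynomial.induction_on with
  | C a => simpa using hasDerivAt_const (0 : ℝ) a
  | add P Q hP hQ => simpa using hP.fun_add hQ
  | mul_X P j hP =>
    have coord : HasDerivAt (fun t : ℝ => (x + t • EuclideanSpace.single i (1 : ℝ)) j)
        (if j = i then 1 else 0) 0 := by
      simp only [PiLp.add_apply, PiLp.smul_apply, PiLp.single_apply, smul_eq_mul]
      simpa using ((hasDerivAt_id (0 : ℝ)).mul_const (if j = i then (1 : ℝ) else 0)).const_add (x j)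
    simp only [map_mul, eval_X, pderiv_mul, map_add, pderiv_X, Pi.single_apply]
    refine (hP.mul coord).congr_deriv ?_
    by_cases h : j = i <;> simp [h]

theorem hasLineDerivAt_exp_neg_norm_sq [DecidableEq ι] (x : EuclideanSpace ℝ ι) (i : ι) :
    HasLineDerivAt ℝ (fun x : EuclideanSpace ℝ ι => exp (-‖x‖ ^ 2))
      (-2 * (exp (-‖x‖ ^ 2) * x i)) x (EuclideanSpace.single i 1) := by
  have normSq := hasLineDerivAt_eval (polyNormSq ι ℝ) x i
  simp only [eval_polyNormSq, pderiv_polyNormSq] at normSq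
  unfold HasLineDerivAt at normSq ⊢
  refine normSq.fun_neg.exp.congr_deriv ?_
  simp
  ring

theorem integral_exp_neg_norm_sq_mul_eval_pderiv (P : MvPolynomial ι ℝ) (i : ι) :
    ∫ x : EuclideanSpace ℝ ι, exp (-‖x‖ ^ 2) * eval (fun i => x i) (pderiv i P) =
      2 * ∫ x : EuclideanSpace ℝ ι, exp (-‖x‖ ^ 2) * eval (fun i => x i) (X i * P) := by
  classical
  have deriv_mul (x : EuclideanSpace ℝ ι) :
      -2 * (exp (-‖x‖ ^ 2) * x i) * eval (fun i => x i) P =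
        -2 * (exp (-‖x‖ ^ 2) * eval (fun i => x i) (X i * P)) := by
    simp only [map_mul, eval_X]
    ring
  have byParts := integral_bilinear_hasLineDerivAt_right_eq_neg_left_of_integrable
    (μ := (volume : Measure (EuclideanSpace ℝ ι))) (B := ContinuousLinearMap.mul ℝ ℝ)
    (f := fun x : EuclideanSpace ℝ ι => exp (-‖x‖ ^ 2))
    (g := fun x : EuclideanSpace ℝ ι => eval (fun i => x i) P) (v := EuclideanSpace.single i 1)
    (by simpa only [ContinuousLinearMap.mul_apply', deriv_mul] using
      (integrable_exp_neg_norm_sq_mul_eval _).const_mul _)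
    (integrable_exp_neg_norm_sq_mul_eval _) (integrable_exp_neg_norm_sq_mul_eval _)
    (fun x _ => hasLineDerivAt_exp_neg_norm_sq x i) (fun x _ => hasLineDerivAt_eval P x i)
  simp only [ContinuousLinearMap.mul_apply', deriv_mul, integral_const_mul] at byParts
  linarith

end GaussianWeight

section SphericalHarmonics

open MvPolynomial

variable {d : ℕ}

theorem isSolidHarmonic_iff {m : ℕ} {Y : MvPolynomial (Fin d) ℝ} :
    IsSolidHarmonic m Y ↔ Y.IsHomogeneous m ∧ polyLaplacian (Fin d) ℝ Y = 0 := by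
  rw [IsSolidHarmonic, polyLaplacian_apply]

instance : IsFiniteMeasure (sphereMeasure d) :=
  inferInstanceAs (IsFiniteMeasure (volume : Measure (EuclideanSpace ℝ (Fin d))).toSphere)

instance : (sphereMeasure d).IsOpenPosMeasure :=
  inferInstanceAs (volume : Measure (EuclideanSpace ℝ (Fin d))).toSphere.IsOpenPosMeasure

theorem sphereArea_pos [NeZero d] : 0 < sphereArea d := by
  have : NeZero (sphereMeasure d) :=
    ⟨Measure.toSphere_ne_zero (volume : Measure (EuclideanSpace ℝ (Fin d)))⟩
  exact measureReal_univ_pos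

/-- The restriction of a polynomial to the unit sphere; for solid harmonics these are the spherical
harmonics. -/
def sphereEval (Y : MvPolynomial (Fin d) ℝ) (ξ : UnitSphere d) : ℝ :=
  eval (fun i => (ξ : EuclideanSpace ℝ (Fin d)) i) Y

@[fun_prop]
theorem continuous_sphereEval (Y : MvPolynomial (Fin d) ℝ) : Continuous (sphereEval Y) :=
  (MvPolynomial.continuous_eval Y).comp (continuous_pi fun i => by fun_prop)

theorem sphereEval_polyNormSq (ξ : UnitSphere d) : sphereEval (polyNormSq (Fin d) ℝ) ξ = 1 := by
  rw [sphereEval, eval_polyNormSq, norm_eq_of_mem_sphere, one_pow]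

theorem memLp_of_continuous_sphere {F : UnitSphere d → ℝ} (hF : Continuous F) :
    MemLp F 2 (sphereMeasure d) :=
  hF.memLp_of_hasCompactSupport (.of_compactSpace F)

variable [NeZero d]

theorem integral_exp_neg_norm_sq_mul_eval_of_isHomogeneous {n : ℕ} {P : MvPolynomial (Fin d) ℝ}
    (hP : P.IsHomogeneous n) :
    ∫ x : EuclideanSpace ℝ (Fin d), Real.exp (-‖x‖ ^ 2) * eval (fun i => x i) P =
      (∫ ξ, sphereEval P ξ ∂sphereMeasure d) * (1 / 2 * Real.Gamma ((n + d) / 2)) := by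
  have separated (r : ℝ) (hr : 0 < r) (ξ : UnitSphere d) :
      Real.exp (-‖r • (ξ : EuclideanSpace ℝ (Fin d))‖ ^ 2) *
        eval (fun i => (r • (ξ : EuclideanSpace ℝ (Fin d))) i) P =
      sphereEval P ξ * (r ^ n * Real.exp (-r ^ 2)) := by
    simp only [norm_smul, norm_eq_of_mem_sphere, Real.norm_eq_abs, abs_of_pos hr, mul_one,
      PiLp.smul_apply, smul_eq_mul, sphereEval, eval_const_mul_of_isHomogeneous hP]
    ring
  have hd : 1 ≤ d := NeZero.one_le
  have radial : ∫ r in Set.Ioi (0 : ℝ), r ^ (d - 1) * (r ^ n * Real.exp (-r ^ 2)) =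
      1 / 2 * Real.Gamma ((n + d) / 2) := by
    have gamma := integral_rpow_mul_exp_neg_rpow (p := 2) (q := (n + (d - 1) : ℕ)) two_pos
      (by linarith [(n + (d - 1)).cast_nonneg (α := ℝ)])
    rw [show ((n + (d - 1) : ℕ) : ℝ) + 1 = n + d by push_cast [hd]; ring] at gamma
    rw [← gamma]
    refine integral_congr_ae (.of_forall fun r => ?_)
    simp only [Real.rpow_natCast, Real.rpow_ofNat]
    ring
  rw [integral_eq_integral_sphere_mul_integral_Ioi volume separated, finrank_euclideanSpace_fin,
    radial]
  rfl

/- With `W = Y ∇Z - Z ∇Y` one has `div W = 0` and `x · W = (m - j) Y Z` by Euler's identity;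
integrating `div W` by parts against the Gaussian gives the integral of `x · W`. -/
theorem integral_sphereEval_mul_eq_zero {j m : ℕ} (hjm : j ≠ m) {Y Z : MvPolynomial (Fin d) ℝ}
    (hY : IsSolidHarmonic j Y) (hZ : IsSolidHarmonic m Z) :
    ∫ ξ, sphereEval Y ξ * sphereEval Z ξ ∂sphereMeasure d = 0 := by
  set W : Fin d → MvPolynomial (Fin d) ℝ := fun i => Y * pderiv i Z - Z * pderiv i Y
  have divergence : ∑ i, pderiv i (W i) = 0 := by
    have (i : Fin d) : pderiv i (W i) = Y * pderiv i (pderiv i Z) - Z * pderiv i (pderiv i Y) := by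
      simp only [W, map_sub, pderiv_mul]
      ring
    simp only [this, Finset.sum_sub_distrib, ← Finset.mul_sum, hY.2, hZ.2, mul_zero, sub_zero]
  have radial : ∑ i, X i * W i = ((m : ℝ) - j) • (Y * Z) := by
    have (i : Fin d) : X i * W i = Y * (X i * pderiv i Z) - Z * (X i * pderiv i Y) := by
      simp only [W]
      ring
    simp only [this, Finset.sum_sub_distrib, ← Finset.mul_sum, hY.1.sum_X_mul_pderiv,
      hZ.1.sum_X_mul_pderiv, nsmul_eq_mul, smul_eq_C_mul, map_sub, map_natCast]
    ring
  have gaussian_mul : ∫ x : EuclideanSpace ℝ (Fin d),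
      Real.exp (-‖x‖ ^ 2) * eval (fun i => x i) (((m : ℝ) - j) • (Y * Z)) = 0 := by
    have gaussian_divergence : ∫ x : EuclideanSpace ℝ (Fin d),
        Real.exp (-‖x‖ ^ 2) * eval (fun i => x i) (∑ i, pderiv i (W i)) = 0 := by
      simp [divergence]
    rw [← radial]
    simp only [map_sum (eval _), Finset.mul_sum] at gaussian_divergence ⊢
    rw [integral_finsetSum _ fun i _ => integrable_exp_neg_norm_sq_mul_eval _]
      at gaussian_divergence ⊢
    simpa only [integral_exp_neg_norm_sq_mul_eval_pderiv, ← Finset.mul_sum, mul_eq_zero,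
      two_ne_zero, false_or] using gaussian_divergence
  have hmj : (m : ℝ) - j ≠ 0 := sub_ne_zero.2 (by exact_mod_cast hjm.symm)
  have hd : (0 : ℝ) < d := by exact_mod_cast NeZero.pos d
  have hΓ : Real.Gamma ((j + m + d : ℝ) / 2) ≠ 0 := (Real.Gamma_pos_of_pos (by positivity)).ne'
  simp only [smul_eval, mul_left_comm _ ((m : ℝ) - j), integral_const_mul,
    integral_exp_neg_norm_sq_mul_eval_of_isHomogeneous (hY.1.mul hZ.1)] at gaussian_mul
  simpa [hmj, hΓ, sphereEval] using gaussian_mul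

theorem sphereEval_mem_span_solidHarmonic (P : MvPolynomial (Fin d) ℝ) :
    sphereEval P ∈ Submodule.span ℝ
      {φ : UnitSphere d → ℝ | ∃ m Y, IsSolidHarmonic m Y ∧ φ = sphereEval Y} := by
  let restrict : MvPolynomial (Fin d) ℝ →ₗ[ℝ] (UnitSphere d → ℝ) :=
    LinearMap.pi fun ξ => (aeval (R := ℝ)
      (fun i => (ξ : EuclideanSpace ℝ (Fin d)) i)).toLinearMap
  have restrict_apply (Q) : restrict Q = sphereEval Q := by
    funext ξ
    simp [restrict, sphereEval, aeval_eq_eval]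
  rw [← restrict_apply, ← sum_homogeneousComponent P, map_sum]
  refine Submodule.sum_mem _ fun n _ => ?_
  have component := Submodule.mem_map_of_mem (f := restrict)
    (mem_span_fischerTerms (homogeneousComponent_isHomogeneous n P))
  rw [Submodule.map_span] at component
  refine Submodule.span_mono ?_ component
  rintro _ ⟨_, ⟨j, m, Y, -, hY, hΔ, rfl⟩, rfl⟩
  refine ⟨m, Y, isSolidHarmonic_iff.2 ⟨hY, hΔ⟩, ?_⟩
  rw [restrict_apply]
  funext ξ
  have := sphereEval_polyNormSq ξ
  simp_all [sphereEval]

theorem ae_eq_zero_of_integral_mul_subalgebra {X : Type*} [TopologicalSpace X] [CompactSpace X]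
    [NormalSpace X] [MeasurableSpace X] [BorelSpace X] {μ : Measure X} [IsFiniteMeasure μ]
    [μ.WeaklyRegular] {A : Subalgebra ℝ C(X, ℝ)} (hA : A.SeparatesPoints) {G : X → ℝ}
    (hG : MemLp G 2 μ) (orthogonal : ∀ φ ∈ A, ∫ x, G x * φ x ∂μ = 0) : G =ᵐ[μ] 0 := by
  let toL2 := ContinuousMap.toLp (E := ℝ) 2 μ ℝ
  have dense : Dense (toL2 '' A) := by
    refine (ContinuousMap.toLp_denseRange ℝ μ ℝ (p := 2) ENNReal.ofNat_ne_top).dense_image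
      toL2.continuous ?_
    rw [dense_iff_closure_eq, ← Subalgebra.topologicalClosure_coe,
      ContinuousMap.subalgebra_topologicalClosure_eq_top_of_separatesPoints A hA, Algebra.coe_top]
  have toLp_eq_zero : hG.toLp = 0 := by
    refine dense.eq_zero_of_inner_left ℝ ?_
    rintro _ ⟨φ, hφ, rfl⟩
    rw [L2.inner_def, ← orthogonal φ hφ]
    refine integral_congr_ae ?_
    filter_upwards [hG.coeFn_toLp, ContinuousMap.coeFn_toLp (p := 2) μ (𝕜 := ℝ) φ] with x hx hφx
    simp only [toL2, hx, hφx, RCLike.inner_apply, conj_trivial, mul_comm]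
  exact hG.coeFn_toLp.symm.trans ((Lp.eq_zero_iff_ae_eq_zero).1 toLp_eq_zero)

theorem ae_eq_zero_of_integral_mul_sphereEval {d : ℕ} {G : UnitSphere d → ℝ}
    (hG : MemLp G 2 (sphereMeasure d))
    (orthogonal : ∀ P, ∫ ξ, G ξ * sphereEval P ξ ∂sphereMeasure d = 0) :
    G =ᵐ[sphereMeasure d] 0 := by
  let restrict : MvPolynomial (Fin d) ℝ →ₐ[ℝ] C(UnitSphere d, ℝ) :=
    aeval fun i => ⟨fun ξ => (ξ : EuclideanSpace ℝ (Fin d)) i, by fun_prop⟩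
  have restrict_apply (P ξ) : restrict P ξ = sphereEval P ξ := by
    induction P using MvPolynomial.induction_on with
    | C a => simp [restrict, sphereEval]
    | add P Q hP hQ => simp [hP, hQ, sphereEval]
    | mul_X P j hP => simp [hP, restrict, sphereEval]
  have separates : restrict.range.SeparatesPoints := by
    intro ξ η hne
    obtain ⟨i, hi⟩ : ∃ i, (ξ : EuclideanSpace ℝ (Fin d)) i ≠ (η : EuclideanSpace ℝ (Fin d)) i := by
      by_contra! hcon
      exact hne (Subtype.ext (PiLp.ext hcon))
    exact ⟨_, ⟨restrict (X i), ⟨X i, rfl⟩, rfl⟩, by simpa [restrict_apply, sphereEval] using hi⟩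
  refine ae_eq_zero_of_integral_mul_subalgebra separates hG ?_
  rintro _ ⟨P, rfl⟩
  rw [AlgHom.toRingHom_eq_coe, RingHom.coe_coe]
  simpa only [restrict_apply] using orthogonal P

theorem integrable_fun_mul_of_memLp {X : Type*} [MeasurableSpace X] {μ : Measure X} {F G : X → ℝ}
    (hF : MemLp F 2 μ) (hG : MemLp G 2 μ) : Integrable (fun x => F x * G x) μ :=
  hF.integrable_mul hG

theorem integral_mul_eq_zero_of_mem_span {X : Type*} [MeasurableSpace X] {μ : Measure X}
    {G : X → ℝ} (hG : MemLp G 2 μ) {S : Set (X → ℝ)}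
    (hS : ∀ φ ∈ S, MemLp φ 2 μ ∧ ∫ x, G x * φ x ∂μ = 0) {φ : X → ℝ}
    (hφ : φ ∈ Submodule.span ℝ S) : MemLp φ 2 μ ∧ ∫ x, G x * φ x ∂μ = 0 := by
  induction hφ using Submodule.span_induction with
  | mem φ hφ => exact hS φ hφ
  | zero => exact ⟨MemLp.zero, by simp⟩
  | add φ ψ _ _ hφ hψ =>
    refine ⟨hφ.1.add hψ.1, ?_⟩
    simp only [Pi.add_apply, mul_add]
    rw [integral_add (integrable_fun_mul_of_memLp hG hφ.1) (integrable_fun_mul_of_memLp hG hψ.1),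
      hφ.2, hψ.2, add_zero]
  | smul c φ _ hφ =>
    refine ⟨hφ.1.const_smul c, ?_⟩
    simp only [Pi.smul_apply, smul_eq_mul, mul_left_comm, integral_const_mul, hφ.2, mul_zero]

theorem exists_countable_solidHarmonic_span : ∃ C : Set (UnitSphere d → ℝ), C.Countable ∧
    (∀ φ ∈ C, ∃ m Y, IsSolidHarmonic m Y ∧ φ = sphereEval Y) ∧
    ∀ P, sphereEval P ∈ Submodule.span ℝ C := by
  choose T hT hmem using fun a : Fin d →₀ ℕ =>
    Submodule.mem_span_finite_of_mem_span (sphereEval_mem_span_solidHarmonic (monomial a 1))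
  refine ⟨⋃ a, T a, Set.countable_iUnion fun a => (T a).countable_toSet, ?_, fun P => ?_⟩
  · intro φ hφ
    obtain ⟨a, ha⟩ := Set.mem_iUnion.1 hφ
    exact hT a ha
  have monomials : sphereEval P = ∑ a ∈ P.support, P.coeff a • sphereEval (monomial a 1) := by
    funext ξ
    simp [sphereEval, eval_eq']
  rw [monomials]
  refine Submodule.sum_mem _ fun a _ => Submodule.smul_mem _ _ ?_
  exact Submodule.span_mono (Set.subset_iUnion_of_subset a subset_rfl) (hmem a)

theorem eventually_ae_eq_zero_of_integral_mul_solidHarmonic {ι : Type*} {l : Filter ι}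
    [CountableInterFilter l] {G : ι → UnitSphere d → ℝ}
    (hG : ∀ᶠ i in l, MemLp (G i) 2 (sphereMeasure d))
    (orthogonal : ∀ m Y, IsSolidHarmonic m Y →
      ∀ᶠ i in l, ∫ ξ, G i ξ * sphereEval Y ξ ∂sphereMeasure d = 0) :
    ∀ᶠ i in l, G i =ᵐ[sphereMeasure d] 0 := by
  obtain ⟨C, countable, harmonic, spans⟩ := exists_countable_solidHarmonic_span (d := d)
  have orthogonal_C : ∀ᶠ i in l, ∀ φ ∈ C, ∫ ξ, G i ξ * φ ξ ∂sphereMeasure d = 0 := by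
    refine (eventually_countable_ball countable).2 fun φ hφ => ?_
    obtain ⟨m, Y, hY, rfl⟩ := harmonic φ hφ
    exact orthogonal m Y hY
  filter_upwards [hG, orthogonal_C] with i hi hiC
  refine ae_eq_zero_of_integral_mul_sphereEval hi fun P =>
    (integral_mul_eq_zero_of_mem_span hi (fun φ hφ => ⟨?_, hiC φ hφ⟩) (spans P)).2
  obtain ⟨m, Y, -, rfl⟩ := harmonic φ hφ
  exact memLp_of_continuous_sphere (continuous_sphereEval Y)

theorem ae_eq_zero_of_integral_mul_solidHarmonic {G : UnitSphere d → ℝ}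
    (hG : MemLp G 2 (sphereMeasure d))
    (orthogonal : ∀ m Y, IsSolidHarmonic m Y → ∫ ξ, G ξ * sphereEval Y ξ ∂sphereMeasure d = 0) :
    G =ᵐ[sphereMeasure d] 0 := by
  simpa using eventually_ae_eq_zero_of_integral_mul_solidHarmonic (l := (⊤ : Filter Unit))
    (G := fun _ => G) (by simpa) (by simpa)

end SphericalHarmonics

section AbsolutelyContinuousChains

open Set

/-- The functions `φ 0, …, φ (s - 1)` are locally absolutely continuous on `(0, 1]`, and the
derivative of `φ k` is `φ (k + 1)`. The last function `φ s` is only integrable on each `[t, 1]`. -/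
def IsACChain (s : ℕ) (φ : ℕ → ℝ → ℝ) : Prop :=
  ∀ k < s, ∀ t ∈ Ioc (0 : ℝ) 1, IntervalIntegrable (φ (k + 1)) volume t 1 ∧
    φ k 1 - φ k t = ∫ v in t..1, φ (k + 1) v

theorem eventually_mem_Ioo_nhdsLT_one : ∀ᶠ t : ℝ in 𝓝[<] 1, t ∈ Ioo (0 : ℝ) 1 :=
  Ioo_mem_nhdsLT one_pos

theorem ae_eq_zero_of_integral_eq_zero {ψ : ℝ → ℝ}
    (h : ∀ t ∈ Ioc (0 : ℝ) 1, IntervalIntegrable ψ volume t 1 ∧ ∫ v in t..1, ψ v = 0) :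
    ∀ᵐ t ∂volume.restrict (Ioc (0 : ℝ) 1), ψ t = 0 := by
  have ae_zero_Ioo (n : ℕ) : ∀ᵐ x : ℝ, x ∈ Ioo (1 / ((n : ℝ) + 1)) 1 → ψ x = 0 := by
    have left_pos : (0 : ℝ) < 1 / (n + 1) := by positivity
    have left_le : 1 / ((n : ℝ) + 1) ≤ 1 := (div_le_one (by positivity)).2 (by simp)
    filter_upwards [(h _ ⟨left_pos, left_le⟩).1.ae_hasDerivAt_integral] with x hx hxI
    have deriv_eq := hx (by rw [uIcc_of_le left_le]; exact Ioo_subset_Icc_self hxI) 1 (by simp)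
    refine deriv_eq.unique ((hasDerivAt_const x 0).congr_of_eventuallyEq ?_)
    filter_upwards [Ioo_mem_nhds hxI.1 hxI.2] with u hu
    rw [intervalIntegral.integral_symm, (h u ⟨left_pos.trans hu.1, hu.2.le⟩).2, neg_zero]
  rw [← restrict_Ioo_eq_restrict_Ioc, ae_restrict_iff' measurableSet_Ioo]
  filter_upwards [ae_all_iff.2 ae_zero_Ioo] with x hx hxI
  obtain ⟨n, hn⟩ := exists_nat_one_div_lt hxI.1
  exact hx n ⟨hn, hxI.2⟩

namespace IsACChain

variable {s : ℕ} {φ : ℕ → ℝ → ℝ}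

theorem tail (h : IsACChain (s + 1) φ) : IsACChain s fun k => φ (k + 1) :=
  fun k hk => h (k + 1) (by lia)

theorem continuousOn (h : IsACChain s φ) {k : ℕ} (hk : k < s) : ContinuousOn (φ k) (Ioc 0 1) := by
  intro t ht
  have half_mem : t / 2 ∈ Ioc (0 : ℝ) 1 := ⟨by linarith [ht.1], by linarith [ht.1, ht.2]⟩
  have primitive : ContinuousOn (fun u => ∫ v in u..1, φ (k + 1) v) (Icc (t / 2) 1) := by
    rw [← uIcc_of_le half_mem.2]
    refine intervalIntegral.continuousOn_primitive_interval_left ?_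
    rw [uIcc_of_le half_mem.2, ← intervalIntegrable_iff_integrableOn_Icc_of_le half_mem.2]
    exact (h k hk _ half_mem).1
  have continuousOn_Icc : ContinuousOn (φ k) (Icc (t / 2) 1) := by
    refine (continuousOn_const (c := φ k 1)).sub primitive |>.congr fun u hu => ?_
    simp only [Pi.sub_apply, ← (h k hk u ⟨half_mem.1.trans_le hu.1, hu.2⟩).2, sub_sub_cancel]
  refine (continuousOn_Icc t ⟨by linarith [ht.1], ht.2⟩).mono_of_mem_nhdsWithin ?_
  filter_upwards [mem_nhdsWithin_of_mem_nhds (Ioi_mem_nhds (half_lt_self ht.1)),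
    self_mem_nhdsWithin] with u hu hu'
  exact ⟨le_of_lt hu, hu'.2⟩

theorem ae_succ_eq_zero (h : IsACChain s φ) {k : ℕ} (hk : k < s)
    (hz : ∀ t ∈ Ioc (0 : ℝ) 1, φ k t = 0) :
    ∀ᵐ t ∂volume.restrict (Ioc (0 : ℝ) 1), φ (k + 1) t = 0 := by
  refine ae_eq_zero_of_integral_eq_zero fun t ht => ⟨(h k hk t ht).1, ?_⟩
  rw [← (h k hk t ht).2, hz t ht, hz 1 ⟨one_pos, le_rfl⟩, sub_zero]

theorem eq_zero_of_zero (h : IsACChain s φ) (h0 : ∀ t ∈ Ioc (0 : ℝ) 1, φ 0 t = 0) {k : ℕ}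
    (hk : k < s) : ∀ t ∈ Ioc (0 : ℝ) 1, φ k t = 0 := by
  induction k with
  | zero => exact h0
  | succ k ih =>
    exact Measure.eqOn_Ioc_of_ae_eq volume (h.ae_succ_eq_zero (by lia) (ih (by lia)))
      (h.continuousOn hk) continuousOn_const

theorem ae_eq_zero_of_zero (h : IsACChain s φ) (h0 : ∀ t ∈ Ioc (0 : ℝ) 1, φ 0 t = 0) :
    ∀ᵐ t ∂volume.restrict (Ioc (0 : ℝ) 1), φ s t = 0 := by
  cases s with
  | zero => exact ae_restrict_of_forall_mem measurableSet_Ioc h0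
  | succ s => exact h.ae_succ_eq_zero s.lt_succ_self (h.eq_zero_of_zero h0 s.lt_succ_self)

theorem ae_eq_zero_of_top (h : IsACChain s φ) (h1 : ∀ k < s, φ k 1 = 0)
    (htop : ∀ᵐ t ∂volume.restrict (Ioc (0 : ℝ) 1), φ s t = 0) :
    ∀ᵐ t ∂volume.restrict (Ioc (0 : ℝ) 1), φ 0 t = 0 := by
  induction s generalizing φ with
  | zero => exact htop
  | succ s ih =>
    have ae_zero := ih h.tail (fun k hk => h1 (k + 1) (by lia)) htop
    rw [ae_restrict_iff' measurableSet_Ioc] at ae_zero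
    refine ae_restrict_of_forall_mem measurableSet_Ioc fun t ht => ?_
    have sub_eq := (h 0 (by lia) t ht).2
    rw [intervalIntegral.integral_zero_ae, h1 0 (by lia), zero_sub, neg_eq_zero] at sub_eq
    · exact sub_eq
    · filter_upwards [ae_zero] with v hv hvI
      rw [uIoc_of_le ht.2] at hvI
      exact hv ⟨ht.1.trans hvI.1, hvI.2⟩

theorem hasDerivAt (h : IsACChain s φ) {k : ℕ} (hk : k + 1 < s) {t : ℝ}
    (ht : t ∈ Ioo (0 : ℝ) 1) : HasDerivAt (φ k) (φ (k + 1) t) t := by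
  have continuousOn_Ioo := (h.continuousOn hk).mono Ioo_subset_Ioc_self
  have primitive := intervalIntegral.integral_hasDerivAt_left
    (h k (by lia) t (Ioo_subset_Ioc_self ht)).1
    (continuousOn_Ioo.stronglyMeasurableAtFilter isOpen_Ioo t ht)
    (continuousOn_Ioo.continuousAt (Ioo_mem_nhds ht.1 ht.2))
  refine (primitive.const_sub (φ k 1)).congr_of_eventuallyEq ?_ |>.congr_deriv (neg_neg _)
  filter_upwards [Ioo_mem_nhds ht.1 ht.2] with u hu
  rw [← (h k (by lia) u (Ioo_subset_Ioc_self hu)).2, sub_sub_cancel]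

theorem tendsto_nhdsLT_one (h : IsACChain s φ) (hs : 0 < s) :
    Tendsto (φ 0) (𝓝[<] 1) (𝓝 (φ 0 1)) := by
  refine (h.continuousOn hs 1 ⟨one_pos, le_rfl⟩).mono_left (nhdsWithin_le_of_mem ?_)
  filter_upwards [eventually_mem_Ioo_nhdsLT_one] with t ht using Ioo_subset_Ioc_self ht

theorem tendsto_div_pow {k : ℕ} (h : IsACChain s φ) (hk : k < s) (hz : ∀ j < k, φ j 1 = 0) :
    Tendsto (fun t => φ 0 t / (1 - t) ^ k) (𝓝[<] 1) (𝓝 ((-1) ^ k / k.factorial * φ k 1)) := by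
  induction k generalizing s φ with
  | zero => simpa using h.tendsto_nhdsLT_one hk
  | succ k ih =>
    obtain ⟨s, rfl⟩ := Nat.exists_eq_succ_of_ne_zero (Nat.ne_zero_of_lt hk)
    have quotient := (ih h.tail (by lia) fun j hj => hz (j + 1) (by lia)).const_mul
      (-(1 / ((k : ℝ) + 1)))
    refine HasDerivAt.lhopital_zero_nhdsLT (f' := φ 1)
      (g' := fun t => -((k : ℝ) + 1) * (1 - t) ^ k) ?_ ?_ ?_ ?_ ?_ ?_
    · filter_upwards [eventually_mem_Ioo_nhdsLT_one] with t ht using h.hasDerivAt (by lia) ht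
    · refine .of_forall fun t =>
        (((hasDerivAt_id t).const_sub 1).pow (k + 1)).congr_deriv ?_
      simp only [Nat.cast_add, Nat.cast_one, id_eq, add_tsub_cancel_right]
      ring
    · filter_upwards [eventually_mem_Ioo_nhdsLT_one] with t ht
      exact mul_ne_zero (neg_ne_zero.2 (by positivity)) (pow_ne_zero _ (sub_ne_zero.2 ht.2.ne'))
    · simpa only [hz 0 k.succ_pos] using h.tendsto_nhdsLT_one s.succ_pos
    · have : ContinuousAt (fun t : ℝ => (1 - t) ^ (k + 1)) 1 := by fun_prop
      simpa [ContinuousAt] using this.mono_left nhdsWithin_le_nhds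
    · convert quotient using 2 with t
      · rw [zero_add, neg_mul, neg_mul, div_neg, div_mul_div_comm, one_mul]
      · rw [Nat.factorial_succ, Nat.cast_mul, Nat.cast_succ, pow_succ]
        field_simp

theorem eq_zero_of_rim (h : IsACChain s φ)
    (hlim : Tendsto (fun t => φ 0 t / (1 - t) ^ (s - 1)) (𝓝[<] 1) (𝓝 0)) {k : ℕ} (hk : k < s) :
    φ k 1 = 0 := by
  induction k using Nat.strong_induction_on with
  | _ k ih =>
    have tendsto_one_sub : Tendsto (fun t : ℝ => (1 - t) ^ (s - 1 - k)) (𝓝[<] 1)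
        (𝓝 ((1 - 1) ^ (s - 1 - k))) :=
      ((tendsto_const_nhds.sub tendsto_id).pow _).mono_left nhdsWithin_le_nhds
    have tendsto_zero : Tendsto (fun t => φ 0 t / (1 - t) ^ k) (𝓝[<] 1) (𝓝 0) := by
      rw [← zero_mul ((1 - 1 : ℝ) ^ (s - 1 - k))]
      refine (hlim.mul tendsto_one_sub).congr' ?_
      filter_upwards [self_mem_nhdsWithin] with t ht
      have : 1 - t ≠ 0 := sub_ne_zero.2 (ne_of_gt ht)
      rw [← Nat.sub_add_cancel (show k ≤ s - 1 by lia), Nat.add_sub_cancel, pow_add]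
      field_simp
    have := tendsto_nhds_unique (h.tendsto_div_pow hk fun j hj => ih j hj (by lia)) tendsto_zero
    exact (mul_eq_zero.1 this).resolve_left
      (div_ne_zero (pow_ne_zero _ (by norm_num)) (Nat.cast_ne_zero.2 k.factorial_ne_zero))

end IsACChain

end AbsolutelyContinuousChains

section IteratedPrimitives

open Set

section Triangle

variable {a b : ℝ} {w ψ : ℝ → ℝ}

theorem setIntegral_indicator_Iic {v : ℝ} (hv : v ∈ Ioc a b) (F : ℝ → ℝ) :
    ∫ t in Ioc a b, (Iic v).indicator F t = ∫ t in Ioc a v, F t := by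
  rw [setIntegral_indicator measurableSet_Iic, Ioc_inter_Iic, min_eq_right hv.2]

theorem setIntegral_indicator_Ici {t : ℝ} (ht : t ∈ Ioc a b) (F : ℝ → ℝ) :
    ∫ v in Ioc a b, (Ici t).indicator F v = ∫ v in t..b, F v := by
  have inter : Ioc a b ∩ Ici t = Icc t b := by
    ext v
    simp only [mem_inter_iff, mem_Ioc, mem_Ici, mem_Icc]
    exact ⟨fun h => ⟨h.2, h.1.2⟩, fun h => ⟨⟨ht.1.trans_le h.1, h.2⟩, h.1⟩⟩
  rw [setIntegral_indicator measurableSet_Ici, inter, integral_Icc_eq_integral_Ioc,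
    intervalIntegral.integral_of_le ht.2]

theorem integrable_triangle_mul (hw : IntegrableOn w (Ioc a b)) (hw0 : ∀ t ∈ Ioc a b, 0 ≤ w t)
    (hψ : AEStronglyMeasurable ψ (volume.restrict (Ioc a b)))
    (hψw : IntegrableOn (fun v => ψ v * ∫ t in Ioc a v, w t) (Ioc a b)) :
    Integrable ({p : ℝ × ℝ | p.1 ≤ p.2}.indicator fun p => w p.1 * ψ p.2)
      ((volume.restrict (Ioc a b)).prod (volume.restrict (Ioc a b))) := by
  have section_eq (t v : ℝ) : {p : ℝ × ℝ | p.1 ≤ p.2}.indicator (fun p => w p.1 * ψ p.2) (t, v) =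
      (Iic v).indicator (fun t => w t * ψ v) t := rfl
  have measurable : AEStronglyMeasurable
      ({p : ℝ × ℝ | p.1 ≤ p.2}.indicator fun p => w p.1 * ψ p.2)
      ((volume.restrict (Ioc a b)).prod (volume.restrict (Ioc a b))) :=
    (hw.aestronglyMeasurable.comp_fst.mul hψ.comp_snd).indicator
      (measurableSet_le measurable_fst measurable_snd)
  refine (integrable_prod_iff' measurable).2 ⟨.of_forall fun v => ?_, hψw.norm.congr ?_⟩
  · simpa only [section_eq] using (hw.mul_const (ψ v)).indicator measurableSet_Iic
  · filter_upwards [ae_restrict_mem measurableSet_Ioc] with v hv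
    have norm_eq : ∀ t ∈ Ioc a v, ‖w t * ψ v‖ = w t * ‖ψ v‖ := fun t ht => by
      rw [norm_mul, Real.norm_of_nonneg (hw0 t ⟨ht.1, ht.2.trans hv.2⟩)]
    have weight_nonneg : 0 ≤ ∫ t in Ioc a v, w t :=
      setIntegral_nonneg measurableSet_Ioc fun t ht => hw0 t ⟨ht.1, ht.2.trans hv.2⟩
    simp only [section_eq, norm_indicator_eq_indicator_norm]
    rw [setIntegral_indicator_Iic hv, setIntegral_congr_fun measurableSet_Ioc norm_eq,
      integral_mul_const, norm_mul, Real.norm_of_nonneg weight_nonneg, mul_comm]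

theorem integral_primitive_mul (hw : IntegrableOn w (Ioc a b)) (hw0 : ∀ t ∈ Ioc a b, 0 ≤ w t)
    (hψ : AEStronglyMeasurable ψ (volume.restrict (Ioc a b)))
    (hψw : IntegrableOn (fun v => ψ v * ∫ t in Ioc a v, w t) (Ioc a b)) :
    IntegrableOn (fun t => (∫ v in t..b, ψ v) * w t) (Ioc a b) ∧
      ∫ t in Ioc a b, (∫ v in t..b, ψ v) * w t =
        ∫ v in Ioc a b, ψ v * ∫ t in Ioc a v, w t := by
  let kernel (t v : ℝ) : ℝ := {p : ℝ × ℝ | p.1 ≤ p.2}.indicator (fun p => w p.1 * ψ p.2) (t, v)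
  have integrable_kernel := integrable_triangle_mul hw hw0 hψ hψw
  have integral_right : ∀ᵐ t ∂volume.restrict (Ioc a b),
      ∫ v in Ioc a b, kernel t v = (∫ v in t..b, ψ v) * w t := by
    filter_upwards [ae_restrict_mem measurableSet_Ioc] with t ht
    change ∫ v in Ioc a b, (Ici t).indicator (fun v => w t * ψ v) v = _
    rw [setIntegral_indicator_Ici ht, intervalIntegral.integral_const_mul, mul_comm]
  have integral_left : ∀ᵐ v ∂volume.restrict (Ioc a b),
      ∫ t in Ioc a b, kernel t v = ψ v * ∫ t in Ioc a v, w t := by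
    filter_upwards [ae_restrict_mem measurableSet_Ioc] with v hv
    change ∫ t in Ioc a b, (Iic v).indicator (fun t => w t * ψ v) t = _
    rw [setIntegral_indicator_Iic hv, integral_mul_const, mul_comm]
  refine ⟨integrable_kernel.integral_prod_left.congr integral_right, ?_⟩
  rw [← integral_congr_ae integral_right, integral_integral_swap (f := kernel) integrable_kernel,
    integral_congr_ae integral_left]

end Triangle

theorem integral_primitive_mul_rpow {r : ℝ} (hr : -1 < r) {ψ : ℝ → ℝ}
    (hψ : IntegrableOn (fun v => ψ v * v ^ (r + 1)) (Ioc 0 1)) :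
    IntegrableOn (fun t => (∫ v in t..1, ψ v) * t ^ r) (Ioc 0 1) ∧
      ∫ t in Ioc 0 1, (∫ v in t..1, ψ v) * t ^ r =
        (r + 1)⁻¹ * ∫ v in Ioc 0 1, ψ v * v ^ (r + 1) := by
  have weight_integral : ∀ v ∈ Ioc (0 : ℝ) 1, ψ v * ∫ t in Ioc 0 v, t ^ r =
      (r + 1)⁻¹ * (ψ v * v ^ (r + 1)) := fun v hv => by
    rw [← intervalIntegral.integral_of_le hv.1.le, integral_rpow (Or.inl hr),
      Real.zero_rpow (by linarith)]
    ring
  have measurable : AEStronglyMeasurable ψ (volume.restrict (Ioc 0 1)) := by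
    have : AEStronglyMeasurable (fun v : ℝ => ψ v * v ^ (r + 1) * v ^ (-(r + 1)))
        (volume.restrict (Ioc 0 1)) := hψ.aestronglyMeasurable.mul (by fun_prop)
    refine this.congr ?_
    filter_upwards [ae_restrict_mem measurableSet_Ioc] with v hv
    rw [mul_assoc, ← Real.rpow_add hv.1, add_neg_cancel, Real.rpow_zero, mul_one]
  have integrable_rpow : IntegrableOn (fun t : ℝ => t ^ r) (Ioc 0 1) :=
    (intervalIntegrable_iff_integrableOn_Ioc_of_le zero_le_one).1
      (intervalIntegral.intervalIntegrable_rpow' hr)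
  obtain ⟨integrable, integral_eq⟩ := integral_primitive_mul integrable_rpow
    (fun t ht => Real.rpow_nonneg ht.1.le r) measurable
    (IntegrableOn.congr_fun (hψ.const_mul (r + 1)⁻¹)
      (fun v hv => (weight_integral v hv).symm) measurableSet_Ioc)
  refine ⟨integrable, ?_⟩
  rw [integral_eq, setIntegral_congr_fun measurableSet_Ioc weight_integral, integral_const_mul]

theorem IsACChain.integral_mul_rpow {s : ℕ} {φ : ℕ → ℝ → ℝ} (h : IsACChain s φ)
    (h1 : ∀ k < s, φ k 1 = 0) {r : ℝ} (hr : -1 < r)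
    (hi : IntegrableOn (fun v => φ s v * v ^ (r + s)) (Ioc 0 1)) :
    IntegrableOn (fun t => φ 0 t * t ^ r) (Ioc 0 1) ∧
      ∫ t in Ioc 0 1, φ 0 t * t ^ r =
        (∏ i ∈ Finset.range s, -(r + i + 1)⁻¹) * ∫ v in Ioc 0 1, φ s v * v ^ (r + s) := by
  induction s generalizing φ r with
  | zero => simpa using hi
  | succ s ih =>
    have exponent : r + 1 + (s : ℝ) = r + (s + 1 : ℕ) := by push_cast; ring
    obtain ⟨integrable_tail, integral_tail⟩ := ih h.tail (fun k hk => h1 (k + 1) (by lia))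
      (by linarith : -1 < r + 1) (by rwa [exponent])
    have primitive : ∀ t ∈ Ioc (0 : ℝ) 1,
        φ 0 t * t ^ r = -((∫ v in t..1, φ 1 v) * t ^ r) := fun t ht => by
      rw [← (h 0 (by lia) t ht).2, h1 0 (by lia)]
      ring
    obtain ⟨integrable, integral_eq⟩ := integral_primitive_mul_rpow hr integrable_tail
    refine ⟨IntegrableOn.congr_fun integrable.neg (fun t ht => (primitive t ht).symm)
      measurableSet_Ioc, ?_⟩
    rw [setIntegral_congr_fun measurableSet_Ioc primitive, integral_neg, integral_eq]
    rw [zero_add] at integral_tail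
    rw [integral_tail, Finset.prod_range_succ', exponent]
    simp only [Nat.cast_add, Nat.cast_one, Nat.cast_zero, add_zero, add_comm (1 : ℝ), add_assoc]
    ring

end IteratedPrimitives

section ConePolynomials

open MvPolynomial

variable {d : ℕ}

/-- The function `t ^ k * Y(x)` on the conic surface. -/
def coneHarmonic (k : ℕ) (Y : MvPolynomial (Fin d) ℝ) (p : ConeSurface d) : ℝ :=
  p.1.2 ^ k * eval (fun i => p.1.1 i) Y

/-- The functions `t ^ k * Y(x)` on the conic surface with `Y` a solid harmonic, of degree at most
`n`. They span the polynomials of degree at most `n`. -/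
def coneHarmonics (d n : ℕ) : Set (ConeSurface d → ℝ) :=
  {q | ∃ k m Y, k + m ≤ n ∧ IsSolidHarmonic m Y ∧ q = coneHarmonic k Y}

/-- The polynomials of degree at most `n` on the conic surface, as a vector space. -/
def conePolys (d n : ℕ) : Submodule ℝ (ConeSurface d → ℝ) :=
  (restrictTotalDegree (Fin d ⊕ Unit) ℝ n).map
    (LinearMap.pi fun p : ConeSurface d =>
      (aeval (R := ℝ) (Sum.elim (fun i => p.1.1 i) (fun _ => p.1.2))).toLinearMap)

theorem mem_conePolys {n : ℕ} {q : ConeSurface d → ℝ} : q ∈ conePolys d n ↔ IsConePoly n q := by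
  simp only [conePolys, Submodule.mem_map, mem_restrictTotalDegree, IsConePoly]
  refine exists_congr fun P => and_congr_right fun _ => ?_
  rw [eq_comm, funext_iff]
  simp [aeval_eq_eval]

instance (n : ℕ) : Module.Finite ℝ (conePolys d n) :=
  inferInstanceAs (Module.Finite ℝ ((restrictTotalDegree (Fin d ⊕ Unit) ℝ n).map _))

theorem IsConePoly.mono {n k : ℕ} (hnk : n ≤ k) {q : ConeSurface d → ℝ} (hq : IsConePoly n q) :
    IsConePoly k q := by
  obtain ⟨P, hP, h⟩ := hq
  exact ⟨P, hP.trans hnk, h⟩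

theorem IsConePoly.continuous {n : ℕ} {q : ConeSurface d → ℝ} (hq : IsConePoly n q) :
    Continuous q := by
  obtain ⟨P, -, h⟩ := hq
  rw [funext h]
  refine (MvPolynomial.continuous_eval P).comp (continuous_pi ?_)
  rintro (i | i) <;> dsimp only [Sum.elim_inl, Sum.elim_inr] <;> fun_prop

theorem IsConePoly.one_sub_pow_mul {n : ℕ} {q : ConeSurface d → ℝ} (hq : IsConePoly n q) (s : ℕ) :
    IsConePoly (n + s) (fun p => (1 - p.1.2) ^ s * q p) := by
  obtain ⟨P, hP, h⟩ := hq
  have degree_le : (1 - X (Sum.inr ()) : MvPolynomial (Fin d ⊕ Unit) ℝ).totalDegree ≤ 1 :=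
    (totalDegree_sub _ _).trans (by simp)
  refine ⟨(1 - X (Sum.inr ())) ^ s * P, ?_, fun p => by simp [h p]⟩
  calc ((1 - X (Sum.inr ())) ^ s * P).totalDegree
    _ ≤ s * (1 - X (Sum.inr ()) : MvPolynomial (Fin d ⊕ Unit) ℝ).totalDegree + P.totalDegree :=
        (totalDegree_mul _ _).trans (by gcongr; exact totalDegree_pow _ _)
    _ ≤ n + s := by nlinarith

theorem isConePoly_coneHarmonic (k : ℕ) {m : ℕ} {Y : MvPolynomial (Fin d) ℝ}
    (hY : Y.totalDegree ≤ m) : IsConePoly (k + m) (coneHarmonic k Y) := by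
  refine ⟨X (Sum.inr ()) ^ k * rename Sum.inl Y, ?_, fun p => ?_⟩
  · exact (totalDegree_mul _ _).trans
      (add_le_add (by simp) ((totalDegree_rename_le _ _).trans hY))
  · simp [coneHarmonic, eval_rename, Function.comp_def]

theorem continuous_coneHarmonic (k : ℕ) (Y : MvPolynomial (Fin d) ℝ) :
    Continuous (coneHarmonic k Y) :=
  (isConePoly_coneHarmonic k le_rfl).continuous

/- On the cone `‖x‖ ^ 2 = t ^ 2`, so the Fischer decomposition of a homogeneous polynomial in `x` is
an expansion in powers of `t` with solid harmonic coefficients. -/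
theorem coneHarmonic_mem_span [NeZero d] {n k l : ℕ} {P : MvPolynomial (Fin d) ℝ}
    (hP : P.IsHomogeneous l) (hkl : k + l ≤ n) :
    coneHarmonic k P ∈ Submodule.span ℝ (coneHarmonics d n) := by
  let restrict : MvPolynomial (Fin d) ℝ →ₗ[ℝ] (ConeSurface d → ℝ) :=
    LinearMap.pi fun p => (p.1.2 ^ k) • (aeval (R := ℝ) (fun i => p.1.1 i)).toLinearMap
  have restrict_apply (Q) : restrict Q = coneHarmonic k Q := by
    funext p
    simp [restrict, coneHarmonic, aeval_eq_eval]
  have image := Submodule.mem_map_of_mem (f := restrict) (mem_span_fischerTerms hP)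
  rw [Submodule.map_span, restrict_apply] at image
  refine Submodule.span_mono ?_ image
  rintro _ ⟨_, ⟨j, m, Y, hjm, hY, hΔ, rfl⟩, rfl⟩
  refine ⟨k + 2 * j, m, Y, by lia, isSolidHarmonic_iff.2 ⟨hY, hΔ⟩, ?_⟩
  rw [restrict_apply]
  funext p
  simp only [coneHarmonic, map_mul, map_pow, eval_polyNormSq, p.2.1]
  ring

theorem IsConePoly.mem_span_coneHarmonics [NeZero d] {n : ℕ} {q : ConeSurface d → ℝ}
    (hq : IsConePoly n q) : q ∈ Submodule.span ℝ (coneHarmonics d n) := by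
  obtain ⟨P, hP, hq⟩ := hq
  have monomials : q = ∑ a ∈ P.support, P.coeff a •
      coneHarmonic (a (Sum.inr ())) (∏ i, X i ^ a (Sum.inl i)) := by
    funext p
    rw [hq p, eval_eq']
    simp [Fintype.prod_sum_type, coneHarmonic, mul_comm]
  rw [monomials]
  refine Submodule.sum_mem _ fun a ha => Submodule.smul_mem _ _ ?_
  refine coneHarmonic_mem_span (IsHomogeneous.prod _ _ _ fun i _ => isHomogeneous_X_pow i _) ?_
  refine le_trans (Eq.le ?_) ((le_totalDegree ha).trans hP)
  rw [Finsupp.sum_fintype _ _ fun _ => rfl, Fintype.sum_sum_type]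
  simp [add_comm]

end ConePolynomials

section ConeMeasure

open Set

variable {d : ℕ} {β γ : ℝ}

/-- The density `t ^ (d - 1) * w_{β,γ}(t)` of the weighted measure of the conic surface in the
coordinates `(t, ξ) ↦ (t ξ, t)`. -/
def radialWeight (d : ℕ) (β γ t : ℝ) : ℝ := t ^ (d - 1) * (t ^ β * (1 - t) ^ γ)

/-- The measure on `(0, 1]` with density `radialWeight d β γ`. -/
def radialMeasure (d : ℕ) (β γ : ℝ) : Measure ℝ :=
  (volume.restrict (Ioc 0 1)).withDensity fun t => ENNReal.ofReal (radialWeight d β γ t)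

@[fun_prop]
theorem measurable_radialWeight : Measurable (radialWeight d β γ) := by
  unfold radialWeight
  fun_prop

theorem radialWeight_nonneg {t : ℝ} (ht : t ∈ Ioc 0 1) : 0 ≤ radialWeight d β γ t :=
  mul_nonneg (pow_nonneg ht.1.le _)
    (mul_nonneg (Real.rpow_nonneg ht.1.le _) (Real.rpow_nonneg (sub_nonneg.2 ht.2) _))

theorem radialWeight_pos {t : ℝ} (ht : t ∈ Ioo 0 1) : 0 < radialWeight d β γ t :=
  mul_pos (pow_pos ht.1 _)
    (mul_pos (Real.rpow_pos_of_pos ht.1 _) (Real.rpow_pos_of_pos (sub_pos.2 ht.2) _))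

theorem measurable_conePoint : Measurable fun p : ℝ × UnitSphere d => conePoint p.1 p.2 :=
  (continuous_conePoint d).measurable

instance : SigmaFinite (radialMeasure d β γ) :=
  SigmaFinite.withDensity_ofReal _

theorem weightedConeMeasure_zero_zero : weightedConeMeasure d 0 0 = coneMeasure d := by
  simp [weightedConeMeasure]

theorem withDensity_radialWeight :
    ((volume.restrict (Ioc 0 1)).withDensity fun t : ℝ => ENNReal.ofReal (t ^ (d - 1))).withDensity
      (fun t => ENNReal.ofReal (t ^ β * (1 - t) ^ γ)) = radialMeasure d β γ := by
  rw [radialMeasure, ← withDensity_mul _ (by fun_prop) (by fun_prop)]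
  refine withDensity_congr_ae ?_
  filter_upwards [ae_restrict_mem measurableSet_Ioc] with t ht
  rw [Pi.mul_apply, radialWeight, ENNReal.ofReal_mul (pow_nonneg ht.1.le _)]

theorem weightedConeMeasure_eq_map :
    weightedConeMeasure d β γ = ((radialMeasure d β γ).prod (sphereMeasure d)).map
      fun p : ℝ × UnitSphere d => conePoint p.1 p.2 := by
  set ρ := (volume.restrict (Ioc 0 1)).withDensity fun t : ℝ => ENNReal.ofReal (t ^ (d - 1))
    with hρ
  have fst_mem : ∀ᵐ z ∂ρ.prod (sphereMeasure d), z.1 ∈ Ioc (0 : ℝ) 1 :=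
    Measure.quasiMeasurePreserving_fst.ae <|
      (withDensity_absolutelyContinuous _ _).ae_le (ae_restrict_mem measurableSet_Ioc)
  rw [← withDensity_radialWeight, prod_withDensity_left (by fun_prop), weightedConeMeasure,
    coneMeasure, ← hρ]
  ext A hA
  rw [withDensity_apply _ hA, setLIntegral_map hA (by fun_prop) measurable_conePoint,
    Measure.map_apply measurable_conePoint hA, withDensity_apply _ (measurable_conePoint hA)]
  refine lintegral_congr_ae (ae_restrict_of_ae ?_)
  filter_upwards [fst_mem] with z hz
  rw [conePoint_val hz.1.le hz.2]

theorem integrable_radialMeasure_iff {φ : ℝ → ℝ} :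
    Integrable φ (radialMeasure d β γ) ↔
      IntegrableOn (fun t => radialWeight d β γ t * φ t) (Ioc 0 1) := by
  rw [radialMeasure, integrable_withDensity_iff_integrable_smul' (by fun_prop) (by simp)]
  refine integrable_congr ?_
  filter_upwards [ae_restrict_mem measurableSet_Ioc] with t ht
  rw [ENNReal.toReal_ofReal (radialWeight_nonneg ht), smul_eq_mul]

theorem integral_radialMeasure (φ : ℝ → ℝ) :
    ∫ t, φ t ∂radialMeasure d β γ = ∫ t in Ioc 0 1, radialWeight d β γ t * φ t := by
  rw [radialMeasure, integral_withDensity_eq_integral_toReal_smul (by fun_prop) (by simp)]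
  refine integral_congr_ae ?_
  filter_upwards [ae_restrict_mem measurableSet_Ioc] with t ht
  rw [ENNReal.toReal_ofReal (radialWeight_nonneg ht), smul_eq_mul]

theorem integral_weightedCone {F : ConeSurface d → ℝ}
    (hF : Integrable F (weightedConeMeasure d β γ)) :
    IntegrableOn (fun t => radialWeight d β γ t * ∫ ξ, F (conePoint t ξ) ∂sphereMeasure d)
      (Ioc 0 1) ∧
    ∫ p, F p ∂weightedConeMeasure d β γ =
      ∫ t in Ioc 0 1, radialWeight d β γ t * ∫ ξ, F (conePoint t ξ) ∂sphereMeasure d := by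
  have hFm := hF.aestronglyMeasurable
  rw [weightedConeMeasure_eq_map] at hF hFm ⊢
  have hF' : Integrable (fun p : ℝ × UnitSphere d => F (conePoint p.1 p.2))
      ((radialMeasure d β γ).prod (sphereMeasure d)) :=
    (integrable_map_measure hFm measurable_conePoint.aemeasurable).1 hF
  refine ⟨integrable_radialMeasure_iff.1 hF'.integral_prod_left, ?_⟩
  rw [← integral_radialMeasure, ← integral_prod _ hF']
  exact integral_map measurable_conePoint.aemeasurable hFm

theorem isFiniteMeasure_weightedCone [NeZero d] (hβ : -(d : ℝ) < β) (hγ : 0 ≤ γ) :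
    IsFiniteMeasure (weightedConeMeasure d β γ) := by
  have hd : 1 ≤ d := NeZero.one_le
  have integrable_rpow : IntegrableOn (fun t : ℝ => t ^ ((d - 1 : ℕ) + β)) (Ioc 0 1) :=
    (intervalIntegrable_iff_integrableOn_Ioc_of_le zero_le_one).1
      (intervalIntegral.intervalIntegrable_rpow' (by push_cast [hd]; linarith))
  have integrable_weight : IntegrableOn (fun t => radialWeight d β γ t * 1) (Ioc 0 1) := by
    refine Integrable.mono integrable_rpow (by fun_prop) ?_
    filter_upwards [ae_restrict_mem measurableSet_Ioc] with t ht
    rw [mul_one, Real.norm_of_nonneg (radialWeight_nonneg ht),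
      Real.norm_of_nonneg (Real.rpow_nonneg ht.1.le _), Real.rpow_add ht.1, Real.rpow_natCast,
      radialWeight]
    gcongr
    · exact pow_nonneg ht.1.le _
    · exact mul_le_of_le_one_right (Real.rpow_nonneg ht.1.le _)
        (Real.rpow_le_one (sub_nonneg.2 ht.2) (by linarith [ht.1]) hγ)
  have : IsFiniteMeasure (radialMeasure d β γ) :=
    (integrable_const_iff_isFiniteMeasure one_ne_zero).1
      (integrable_radialMeasure_iff.2 integrable_weight)
  rw [weightedConeMeasure_eq_map]
  infer_instance

instance : CompactSpace (ConeSurface d) := by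
  refine isCompact_iff_compactSpace.1 (Metric.isCompact_of_isClosed_isBounded ?_ ?_)
  · exact (isClosed_eq (by fun_prop) (by fun_prop)).inter
      ((isClosed_le continuous_const continuous_snd).inter
        (isClosed_le continuous_snd continuous_const))
  · refine (Metric.isBounded_closedBall (x := 0) (r := 1)).subset ?_
    rintro ⟨x, t⟩ ⟨hx, h0, h1⟩
    rw [mem_closedBall_zero_iff, Prod.norm_def]
    exact max_le (hx.trans_le h1) ((Real.norm_of_nonneg h0).trans_le h1)

theorem memLp_of_continuous_cone {μ : Measure (ConeSurface d)} [IsFiniteMeasure μ]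
    {F : ConeSurface d → ℝ} (hF : Continuous F) : MemLp F 2 μ :=
  hF.memLp_of_hasCompactSupport (.of_compactSpace F)

theorem continuous_slice {F : ConeSurface d → ℝ} (hF : Continuous F) (t : ℝ) :
    Continuous fun ξ => F (conePoint t ξ) :=
  hF.comp ((continuous_conePoint d).comp (Continuous.prodMk_right t))

theorem exists_conePoint_eq [NeZero d] (p : ConeSurface d) : ∃ ξ, conePoint p.1.2 ξ = p := by
  obtain ⟨⟨x, t⟩, hx, h0, h1⟩ := p
  obtain ⟨ξ, rfl⟩ : ∃ ξ : UnitSphere d, t • (ξ : EuclideanSpace ℝ (Fin d)) = x := by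
    rcases h0.eq_or_lt with rfl | h0
    · obtain ⟨ξ⟩ : Nonempty (UnitSphere d) :=
        (NormedSpace.sphere_nonempty.2 zero_le_one).to_subtype
      exact ⟨ξ, by rw [zero_smul, eq_comm, ← norm_eq_zero, hx]⟩
    · refine ⟨⟨t⁻¹ • x, ?_⟩, smul_inv_smul₀ h0.ne' x⟩
      simp only at hx h0
      rw [mem_sphere_zero_iff_norm, norm_smul, hx, norm_inv, Real.norm_of_nonneg h0.le,
        inv_mul_cancel₀ h0.ne']
  exact ⟨ξ, Subtype.ext (conePoint_val h0 h1 ξ)⟩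

theorem ae_ae_of_ae_weightedCone {P : ConeSurface d → Prop}
    (h : ∀ᵐ p ∂weightedConeMeasure d β γ, P p) :
    ∀ᵐ t ∂volume.restrict (Ioc 0 1), ∀ᵐ ξ ∂sphereMeasure d, P (conePoint t ξ) := by
  rw [weightedConeMeasure_eq_map] at h
  have hprod := Measure.ae_ae_of_ae_prod (ae_of_ae_map measurable_conePoint.aemeasurable h)
  rw [radialMeasure, ae_withDensity_iff (by fun_prop)] at hprod
  have ne_one : ∀ᵐ t : ℝ ∂volume.restrict (Ioc 0 1), t ≠ 1 := Measure.ae_ne _ 1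
  filter_upwards [hprod, ae_restrict_mem measurableSet_Ioc, ne_one] with t ht htI ht1
  exact ht (by simpa using radialWeight_pos ⟨htI.1, htI.2.lt_of_ne ht1⟩)

theorem ae_eq_zero_of_ae_slice {F : ConeSurface d → ℝ}
    (hF : AEStronglyMeasurable F (coneMeasure d))
    (h : ∀ᵐ t ∂volume.restrict (Ioc 0 1),
      (fun ξ => F (conePoint t ξ)) =ᵐ[sphereMeasure d] 0) :
    F =ᵐ[weightedConeMeasure d β γ] 0 := by
  suffices F =ᵐ[coneMeasure d] 0 from (withDensity_absolutelyContinuous _ _).ae_le this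
  obtain ⟨G, hG, hFG⟩ := hF
  have ae_eq : ∀ᵐ p ∂weightedConeMeasure d 0 0, F p = G p := by
    rwa [weightedConeMeasure_zero_zero]
  have measurableSet_zeros : MeasurableSet {p | G p = 0} :=
    hG.measurable (measurableSet_singleton 0)
  refine hFG.trans ?_
  change ∀ᵐ p ∂coneMeasure d, G p = 0
  rw [coneMeasure, ae_map_iff measurable_conePoint.aemeasurable measurableSet_zeros]
  refine (Measure.ae_prod_iff_ae_ae (measurable_conePoint measurableSet_zeros)).2 ?_
  refine (withDensity_absolutelyContinuous _ _).ae_le ?_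
  filter_upwards [h, ae_ae_of_ae_weightedCone ae_eq] with t hzero heq
  filter_upwards [hzero, heq] with ξ hξ heqξ
  exact heqξ.symm.trans hξ

theorem eq_zero_of_ae_eq_zero_weightedCone [NeZero d] {F : ConeSurface d → ℝ} (hF : Continuous F)
    (h : F =ᵐ[weightedConeMeasure d β γ] 0) : F = 0 := by
  funext p
  obtain ⟨ξ, hξ⟩ := exists_conePoint_eq p
  have ae_zero : (fun t => F (conePoint t ξ)) =ᵐ[volume.restrict (Icc 0 1)] 0 := by
    rw [← restrict_Ioc_eq_restrict_Icc]
    filter_upwards [ae_ae_of_ae_weightedCone h] with t ht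
    exact congr_fun (((continuous_slice hF t).ae_eq_iff_eq _ continuous_const).1 ht) ξ
  have continuous_ray : Continuous fun t => F (conePoint t ξ) :=
    hF.comp ((continuous_conePoint d).comp (Continuous.prodMk_left ξ))
  rw [← hξ]
  exact Measure.eqOn_Icc_of_ae_eq volume zero_ne_one ae_zero continuous_ray.continuousOn
    continuousOn_const p.2.2

end ConeMeasure

section HarmonicCoefficients

open MvPolynomial Set

variable {d : ℕ} {β γ : ℝ} {F G : ConeSurface d → ℝ} {m : ℕ} {Y : MvPolynomial (Fin d) ℝ} {t : ℝ}

theorem harmonicCoeff_eq (F : ConeSurface d → ℝ) (m : ℕ) (Y : MvPolynomial (Fin d) ℝ) (t : ℝ) :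
    harmonicCoeff F m Y t = (t ^ m)⁻¹ * ((1 / sphereArea d) *
      ∫ ξ, F (conePoint t ξ) * sphereEval Y ξ ∂sphereMeasure d) := rfl

theorem integral_slice_mul_sphereEval [NeZero d] (F : ConeSurface d → ℝ) (m : ℕ)
    (Y : MvPolynomial (Fin d) ℝ) (ht : 0 < t) :
    ∫ ξ, F (conePoint t ξ) * sphereEval Y ξ ∂sphereMeasure d =
      sphereArea d * (t ^ m * harmonicCoeff F m Y t) := by
  have := (sphereArea_pos (d := d)).ne'
  rw [harmonicCoeff_eq]
  field_simp

theorem harmonicCoeff_eq_zero_of_ae_eq_zero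
    (h : (fun ξ => F (conePoint t ξ)) =ᵐ[sphereMeasure d] 0) (m : ℕ)
    (Y : MvPolynomial (Fin d) ℝ) : harmonicCoeff F m Y t = 0 := by
  rw [harmonicCoeff_eq, integral_eq_zero_of_ae, mul_zero, mul_zero]
  filter_upwards [h] with ξ hξ
  rw [hξ, Pi.zero_apply, zero_mul]

theorem harmonicCoeff_add_smul
    (hF : MemLp (fun ξ => F (conePoint t ξ)) 2 (sphereMeasure d))
    (hG : MemLp (fun ξ => G (conePoint t ξ)) 2 (sphereMeasure d)) (a b : ℝ) (m : ℕ)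
    (Y : MvPolynomial (Fin d) ℝ) :
    harmonicCoeff (a • F + b • G) m Y t =
      a * harmonicCoeff F m Y t + b * harmonicCoeff G m Y t := by
  have hY := memLp_of_continuous_sphere (continuous_sphereEval Y)
  simp only [harmonicCoeff_eq, Pi.add_apply, Pi.smul_apply, smul_eq_mul, add_mul, mul_assoc]
  rw [integral_add ((integrable_fun_mul_of_memLp hF hY).const_mul a)
    ((integrable_fun_mul_of_memLp hG hY).const_mul b), integral_const_mul, integral_const_mul]
  ring

theorem slice_ae_eq_zero_of_harmonicCoeff [NeZero d] (ht : 0 < t)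
    (hG : MemLp (fun ξ => G (conePoint t ξ)) 2 (sphereMeasure d))
    (h : ∀ m Y, IsSolidHarmonic m Y → harmonicCoeff G m Y t = 0) :
    (fun ξ => G (conePoint t ξ)) =ᵐ[sphereMeasure d] 0 := by
  refine ae_eq_zero_of_integral_mul_solidHarmonic hG fun m Y hY => ?_
  rw [integral_slice_mul_sphereEval G m Y ht, h m Y hY, mul_zero, mul_zero]

theorem ae_eq_zero_of_harmonicCoeff [NeZero d] (hGm : AEStronglyMeasurable G (coneMeasure d))
    (hG : ∀ᵐ t ∂volume.restrict (Ioc 0 1),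
      MemLp (fun ξ => G (conePoint t ξ)) 2 (sphereMeasure d))
    (h : ∀ m Y, IsSolidHarmonic m Y →
      ∀ᵐ t ∂volume.restrict (Ioc 0 1), harmonicCoeff G m Y t = 0) :
    G =ᵐ[weightedConeMeasure d β γ] 0 := by
  refine ae_eq_zero_of_ae_slice hGm
    (eventually_ae_eq_zero_of_integral_mul_solidHarmonic hG fun m Y hY => ?_)
  filter_upwards [h m Y hY, ae_restrict_mem measurableSet_Ioc] with t ht htI
  rw [integral_slice_mul_sphereEval G m Y htI.1, ht, mul_zero, mul_zero]

end HarmonicCoefficients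

section DerivativeChains

open Set

variable {d s : ℕ} {β γ : ℝ} {F G : ℕ → ConeSurface d → ℝ}

namespace IsTDerivChain

theorem isACChain (hF : IsTDerivChain s F) {m : ℕ} {Y : MvPolynomial (Fin d) ℝ}
    (hY : IsSolidHarmonic m Y) : IsACChain s fun k => harmonicCoeff (F k) m Y :=
  fun k hk t ht => hF.deriv k hk m Y hY t ht

theorem slice_rim (hF : IsTDerivChain s F) {k : ℕ} (hk : k < s) :
    MemLp (fun ξ => F k (conePoint 1 ξ)) 2 (sphereMeasure d) :=
  hF.slice k hk 1 (right_mem_Ioc.2 one_pos)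

theorem ae_slice (hF : IsTDerivChain s F) {k : ℕ} (hk : k ≤ s) :
    ∀ᵐ t ∂volume.restrict (Ioc 0 1),
      MemLp (fun ξ => F k (conePoint t ξ)) 2 (sphereMeasure d) := by
  rcases hk.lt_or_eq with h | rfl
  · filter_upwards [ae_restrict_mem measurableSet_Ioc] with t ht using hF.slice k h t ht
  · exact hF.slice_top

theorem isTDeriv_add_smul (hF : IsTDerivChain s F) (hG : IsTDerivChain s G) (a b : ℝ) {k : ℕ}
    (hk : k < s) : IsTDeriv (a • F k + b • G k) (a • F (k + 1) + b • G (k + 1)) := by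
  intro m Y hY t ht
  obtain ⟨integrable_F, deriv_F⟩ := hF.deriv k hk m Y hY t ht
  obtain ⟨integrable_G, deriv_G⟩ := hG.deriv k hk m Y hY t ht
  have coeff_ae_eq : ∀ᵐ v ∂volume, v ∈ uIoc t 1 →
      a * harmonicCoeff (F (k + 1)) m Y v + b * harmonicCoeff (G (k + 1)) m Y v =
        harmonicCoeff (a • F (k + 1) + b • G (k + 1)) m Y v := by
    filter_upwards [(ae_restrict_iff' measurableSet_Ioc).1 (hF.ae_slice hk),
      (ae_restrict_iff' measurableSet_Ioc).1 (hG.ae_slice hk)] with v hFv hGv hv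
    rw [uIoc_of_le ht.2] at hv
    have hv' : v ∈ Ioc (0 : ℝ) 1 := ⟨ht.1.trans hv.1, hv.2⟩
    exact (harmonicCoeff_add_smul (hFv hv') (hGv hv') a b m Y).symm
  constructor
  · exact ((integrable_F.const_mul a).add (integrable_G.const_mul b)).congr_ae
      ((ae_restrict_iff' measurableSet_uIoc).2 coeff_ae_eq)
  · rw [harmonicCoeff_add_smul (hF.slice k hk t ht) (hG.slice k hk t ht),
      harmonicCoeff_add_smul (hF.slice_rim hk) (hG.slice_rim hk),
      ← intervalIntegral.integral_congr_ae coeff_ae_eq,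
      intervalIntegral.integral_add (integrable_F.const_mul a) (integrable_G.const_mul b),
      intervalIntegral.integral_const_mul, intervalIntegral.integral_const_mul, ← deriv_F,
      ← deriv_G]
    ring

theorem add_smul (hF : IsTDerivChain s F) (hG : IsTDerivChain s G) (a b : ℝ) :
    IsTDerivChain s fun k => a • F k + b • G k where
  slice k hk t ht := ((hF.slice k hk t ht).const_smul a).add ((hG.slice k hk t ht).const_smul b)
  meas_top := (hF.meas_top.const_smul a).add (hG.meas_top.const_smul b)
  slice_top := by
    filter_upwards [hF.slice_top, hG.slice_top] with t hFt hGt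
    exact (hFt.const_smul a).add (hGt.const_smul b)
  deriv k hk := hF.isTDeriv_add_smul hG a b hk

theorem sub (hF : IsTDerivChain s F) (hG : IsTDerivChain s G) : IsTDerivChain s (F - G) := by
  have sub_eq : F - G = fun k => (1 : ℝ) • F k + (-1 : ℝ) • G k := by
    funext k
    rw [one_smul, neg_one_smul, Pi.sub_apply, sub_eq_add_neg]
  exact sub_eq ▸ hF.add_smul hG 1 (-1)

theorem slice_ae_eq_zero [NeZero d] (hF : IsTDerivChain s F) (h0 : F 0 = 0) {k : ℕ} (hk : k < s)
    {t : ℝ} (ht : t ∈ Ioc 0 1) : (fun ξ => F k (conePoint t ξ)) =ᵐ[sphereMeasure d] 0 := by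
  refine slice_ae_eq_zero_of_harmonicCoeff ht.1 (hF.slice k hk t ht) fun m Y hY => ?_
  refine (hF.isACChain hY).eq_zero_of_zero (fun u _ => ?_) hk t ht
  exact harmonicCoeff_eq_zero_of_ae_eq_zero (.of_forall (by simp [h0])) m Y

theorem top_ae_eq_zero [NeZero d] (hF : IsTDerivChain s F) (h0 : F 0 = 0) :
    F s =ᵐ[weightedConeMeasure d β γ] 0 := by
  refine ae_eq_zero_of_harmonicCoeff hF.meas_top hF.slice_top fun m Y hY => ?_
  refine (hF.isACChain hY).ae_eq_zero_of_zero fun u _ => ?_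
  exact harmonicCoeff_eq_zero_of_ae_eq_zero (.of_forall (by simp [h0])) m Y

end IsTDerivChain

theorem HasTDerivs.tDeriv_spec {f : ConeSurface d → ℝ} (h : HasTDerivs s f) :
    tDeriv s f 0 = f ∧ IsTDerivChain s (tDeriv s f) := by
  have choose_eq : tDeriv s f = h.choose := by
    funext k
    simp only [tDeriv, dif_pos h]
  exact choose_eq ▸ h.choose_spec

theorem IsTDerivChain.tDeriv_slice_ae_eq [NeZero d] (hF : IsTDerivChain s F) {k : ℕ} (hk : k < s)
    {t : ℝ} (ht : t ∈ Ioc 0 1) :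
    (fun ξ => tDeriv s (F 0) k (conePoint t ξ)) =ᵐ[sphereMeasure d]
      fun ξ => F k (conePoint t ξ) := by
  obtain ⟨zero_eq, chain⟩ := HasTDerivs.tDeriv_spec ⟨F, rfl, hF⟩
  exact sub_ae_eq_zero _ _ |>.1 ((chain.sub hF).slice_ae_eq_zero (sub_eq_zero.2 zero_eq) hk ht)

theorem IsTDerivChain.tDeriv_top_ae_eq [NeZero d] (hF : IsTDerivChain s F) :
    tDeriv s (F 0) s =ᵐ[weightedConeMeasure d β γ] F s := by
  obtain ⟨zero_eq, chain⟩ := HasTDerivs.tDeriv_spec ⟨F, rfl, hF⟩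
  exact sub_ae_eq_zero _ _ |>.1 ((chain.sub hF).top_ae_eq_zero (sub_eq_zero.2 zero_eq))

variable {f g h : ConeSurface d → ℝ}

theorem HasTDerivs.add_smul (hf : HasTDerivs s f) (hg : HasTDerivs s g) (a b : ℝ) :
    HasTDerivs s (a • f + b • g) :=
  ⟨_, by rw [hf.tDeriv_spec.1, hg.tDeriv_spec.1], hf.tDeriv_spec.2.add_smul hg.tDeriv_spec.2 a b⟩

theorem HasTDerivs.tDeriv_add_smul_rim [NeZero d] (hf : HasTDerivs s f) (hg : HasTDerivs s g)
    (a b : ℝ) {k : ℕ} (hk : k < s) :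
    (fun ξ => tDeriv s (a • f + b • g) k (conePoint 1 ξ)) =ᵐ[sphereMeasure d]
      fun ξ => a * tDeriv s f k (conePoint 1 ξ) + b * tDeriv s g k (conePoint 1 ξ) := by
  have ae_eq := (hf.tDeriv_spec.2.add_smul hg.tDeriv_spec.2 a b).tDeriv_slice_ae_eq hk
    (right_mem_Ioc.2 one_pos)
  rwa [hf.tDeriv_spec.1, hg.tDeriv_spec.1] at ae_eq

theorem HasTDerivs.tDeriv_add_smul_top [NeZero d] (hf : HasTDerivs s f) (hg : HasTDerivs s g)
    (a b : ℝ) :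
    tDeriv s (a • f + b • g) s =ᵐ[weightedConeMeasure d β γ]
      a • tDeriv s f s + b • tDeriv s g s := by
  have ae_eq := (hf.tDeriv_spec.2.add_smul hg.tDeriv_spec.2 a b).tDeriv_top_ae_eq
    (β := β) (γ := γ)
  rwa [hf.tDeriv_spec.1, hg.tDeriv_spec.1] at ae_eq

end DerivativeChains

section SobolevInner

open Set

variable {d s : ℕ} {β : ℝ} {lam : ℕ → ℝ} {f g h : ConeSurface d → ℝ}

theorem MemConeSobolev.add_smul [NeZero d] (hf : MemConeSobolev β s f) (hg : MemConeSobolev β s g)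
    (a b : ℝ) : MemConeSobolev β s (a • f + b • g) :=
  ⟨(hf.1.const_smul a).add (hg.1.const_smul b), hf.2.1.add_smul hg.2.1 a b,
    ((hf.2.2.const_smul a).add (hg.2.2.const_smul b)).ae_eq
      (hf.2.1.tDeriv_add_smul_top hg.2.1 a b).symm⟩

theorem integral_add_smul_mul {α : Type*} [MeasurableSpace α] {μ : Measure α} {u v w z : α → ℝ}
    {a b : ℝ} (hz : z =ᵐ[μ] fun x => a * u x + b * v x) (hu : MemLp u 2 μ) (hv : MemLp v 2 μ)
    (hw : MemLp w 2 μ) :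
    ∫ x, z x * w x ∂μ = a * ∫ x, u x * w x ∂μ + b * ∫ x, v x * w x ∂μ := by
  rw [← integral_const_mul, ← integral_const_mul,
    ← integral_add ((integrable_fun_mul_of_memLp hu hw).const_mul a)
      ((integrable_fun_mul_of_memLp hv hw).const_mul b)]
  refine integral_congr_ae ?_
  filter_upwards [hz] with x hx
  rw [hx]
  ring

theorem ae_eq_zero_of_integral_mul_self {α : Type*} [MeasurableSpace α] {μ : Measure α}
    {u : α → ℝ} (hu : MemLp u 2 μ) (h : ∫ x, u x * u x ∂μ = 0) : u =ᵐ[μ] 0 := by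
  rw [integral_eq_zero_iff_of_nonneg (fun x => mul_self_nonneg _)
    (integrable_fun_mul_of_memLp hu hu)] at h
  filter_upwards [h] with x hx
  exact mul_self_eq_zero.1 hx

theorem coneSobolevInner_comm (β : ℝ) (s : ℕ) (lam : ℕ → ℝ) (f g : ConeSurface d → ℝ) :
    coneSobolevInner β s lam f g = coneSobolevInner β s lam g f := by
  simp only [coneSobolevInner, mul_comm]

theorem coneSobolevInner_add_smul [NeZero d] (lam : ℕ → ℝ) (hf : MemConeSobolev β s f)
    (hg : MemConeSobolev β s g) (hh : MemConeSobolev β s h) (a b : ℝ) :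
    coneSobolevInner β s lam (a • f + b • g) h =
      a * coneSobolevInner β s lam f h + b * coneSobolevInner β s lam g h := by
  have rim (k) (hk : k ∈ Finset.range s) := by
    have hk := Finset.mem_range.1 hk
    exact integral_add_smul_mul (hf.2.1.tDeriv_add_smul_rim hg.2.1 a b hk)
      (hf.2.1.tDeriv_spec.2.slice_rim hk) (hg.2.1.tDeriv_spec.2.slice_rim hk)
      (hh.2.1.tDeriv_spec.2.slice_rim hk)
  have rim_sum := Finset.sum_congr rfl fun k hk => congrArg (lam k / sphereArea d * ·) (rim k hk)
  simp only [coneSobolevInner]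
  rw [rim_sum, integral_add_smul_mul (hf.2.1.tDeriv_add_smul_top hg.2.1 a b) hf.2.2 hg.2.2 hh.2.2]
  simp only [mul_add, Finset.sum_add_distrib, Finset.mul_sum, mul_left_comm _ a,
    mul_left_comm _ b]
  ring

theorem tDeriv_ae_eq_zero_of_coneSobolevInner_self [NeZero d] (hlam : ∀ k < s, 0 < lam k)
    (hf : MemConeSobolev β s f) (h : coneSobolevInner β s lam f f = 0) :
    tDeriv s f s =ᵐ[weightedConeMeasure d (β + s) 0] 0 ∧
      ∀ k < s, (fun ξ => tDeriv s f k (conePoint 1 ξ)) =ᵐ[sphereMeasure d] 0 := by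
  have hω := sphereArea_pos (d := d)
  have coeff_pos (k) (hk : k ∈ Finset.range s) : 0 < lam k / sphereArea d :=
    div_pos (hlam k (Finset.mem_range.1 hk)) hω
  have rim_nonneg (k) (hk : k ∈ Finset.range s) := mul_nonneg (coeff_pos k hk).le <|
    integral_nonneg (μ := sphereMeasure d) fun ξ => mul_self_nonneg (tDeriv s f k (conePoint 1 ξ))
  have top_nonneg := mul_nonneg (one_div_pos.2 hω).le <|
    integral_nonneg (μ := weightedConeMeasure d (β + s) 0) fun p => mul_self_nonneg (tDeriv s f s p)
  obtain ⟨top_eq, rim_eq⟩ :=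
    (add_eq_zero_iff_of_nonneg top_nonneg (Finset.sum_nonneg rim_nonneg)).1 h
  refine ⟨ae_eq_zero_of_integral_mul_self hf.2.2
    ((mul_eq_zero.1 top_eq).resolve_left (one_div_pos.2 hω).ne'), fun k hk => ?_⟩
  have hk' := Finset.mem_range.2 hk
  exact ae_eq_zero_of_integral_mul_self (hf.2.1.tDeriv_spec.2.slice_rim hk)
    ((mul_eq_zero.1 ((Finset.sum_eq_zero_iff_of_nonneg rim_nonneg).1 rim_eq k hk')).resolve_left
      (coeff_pos k hk').ne')

theorem eq_zero_of_coneSobolevInner_self [NeZero d] (hlam : ∀ k < s, 0 < lam k)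
    (hf : MemConeSobolev β s f) (h : coneSobolevInner β s lam f f = 0) : f = 0 := by
  obtain ⟨top_zero, rim_zero⟩ := tDeriv_ae_eq_zero_of_coneSobolevInner_self hlam hf h
  obtain ⟨zero_eq, chain⟩ := hf.2.1.tDeriv_spec
  refine eq_zero_of_ae_eq_zero_weightedCone (β := β) (γ := 0) hf.1 <|
    ae_eq_zero_of_harmonicCoeff hf.1.aestronglyMeasurable
      (.of_forall fun t => memLp_of_continuous_sphere (continuous_slice hf.1 t)) fun m Y hY => ?_
  have coeff_zero := (chain.isACChain hY).ae_eq_zero_of_top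
    (fun k hk => harmonicCoeff_eq_zero_of_ae_eq_zero (rim_zero k hk) m Y) <| by
      filter_upwards [ae_ae_of_ae_weightedCone top_zero] with t ht
      exact harmonicCoeff_eq_zero_of_ae_eq_zero ht m Y
  rwa [zero_eq] at coeff_zero

end SobolevInner

section HarmonicDerivatives

open MvPolynomial Set

variable {d s m : ℕ} {β : ℝ} {Y : MvPolynomial (Fin d) ℝ} {t : ℝ}

theorem coneHarmonic_conePoint (hY : Y.IsHomogeneous m) (ht : t ∈ Ioc 0 1) (k : ℕ)
    (ξ : UnitSphere d) : coneHarmonic k Y (conePoint t ξ) = t ^ (k + m) * sphereEval Y ξ := by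
  rw [coneHarmonic, conePoint_val ht.1.le ht.2, pow_add, mul_assoc, sphereEval,
    ← eval_const_mul_of_isHomogeneous hY]
  simp

theorem harmonicCoeff_smul_coneHarmonic [NeZero d] {n : ℕ} {Z : MvPolynomial (Fin d) ℝ}
    (hY : IsSolidHarmonic m Y) (hZ : IsSolidHarmonic n Z) (a : ℝ) (k : ℕ) (ht : t ∈ Ioc 0 1) :
    harmonicCoeff (a • coneHarmonic k Y) n Z t = (1 / sphereArea d *
      ∫ ξ, sphereEval Y ξ * sphereEval Z ξ ∂sphereMeasure d) * (a * t ^ k) := by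
  simp only [harmonicCoeff_eq, Pi.smul_apply, coneHarmonic_conePoint hY.1 ht, smul_eq_mul,
    mul_assoc]
  rw [integral_const_mul, integral_const_mul]
  rcases eq_or_ne m n with rfl | hmn
  · have := (pow_pos ht.1 m).ne'
    rw [pow_add]
    field_simp
  · rw [integral_sphereEval_mul_eq_zero hmn hY hZ]
    ring

theorem integral_descFactorial_mul_pow (k j : ℕ) (t : ℝ) :
    ∫ v in t..1, (k.descFactorial (j + 1) : ℝ) * v ^ (k - (j + 1)) =
      k.descFactorial j * 1 ^ (k - j) - k.descFactorial j * t ^ (k - j) := by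
  refine intervalIntegral.integral_eq_sub_of_hasDerivAt
    (f := fun v => (k.descFactorial j : ℝ) * v ^ (k - j)) (fun v _ => ?_)
    (Continuous.intervalIntegrable (by fun_prop) _ _)
  refine ((hasDerivAt_pow (k - j) v).const_mul (k.descFactorial j : ℝ)).congr_deriv ?_
  rw [Nat.descFactorial_succ, Nat.cast_mul, Nat.sub_sub]
  ring

theorem isTDeriv_smul_coneHarmonic [NeZero d] (hY : IsSolidHarmonic m Y) (k j : ℕ) :
    IsTDeriv ((k.descFactorial j : ℝ) • coneHarmonic (k - j) Y)
      ((k.descFactorial (j + 1) : ℝ) • coneHarmonic (k - (j + 1)) Y) := by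
  intro n Z hZ t ht
  set c := 1 / sphereArea d * ∫ ξ, sphereEval Y ξ * sphereEval Z ξ ∂sphereMeasure d
  have coeff_eq : EqOn
      (harmonicCoeff ((k.descFactorial (j + 1) : ℝ) • coneHarmonic (k - (j + 1)) Y) n Z)
      (fun v => c * (k.descFactorial (j + 1) * v ^ (k - (j + 1)))) (uIcc t 1) := by
    intro v hv
    rw [uIcc_of_le ht.2] at hv
    exact harmonicCoeff_smul_coneHarmonic hY hZ _ _ ⟨ht.1.trans_le hv.1, hv.2⟩
  constructor
  · exact (Continuous.intervalIntegrable (by fun_prop) t 1).congr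
      (coeff_eq.symm.mono uIoc_subset_uIcc)
  · rw [intervalIntegral.integral_congr coeff_eq, intervalIntegral.integral_const_mul,
      integral_descFactorial_mul_pow, harmonicCoeff_smul_coneHarmonic hY hZ _ _ ht,
      harmonicCoeff_smul_coneHarmonic hY hZ _ _ (right_mem_Ioc.2 one_pos), mul_sub]

theorem isTDerivChain_coneHarmonic [NeZero d] (hY : IsSolidHarmonic m Y) (s k : ℕ) :
    IsTDerivChain s fun j => (k.descFactorial j : ℝ) • coneHarmonic (k - j) Y where
  slice j _ t _ := memLp_of_continuous_sphere
    (continuous_slice ((continuous_coneHarmonic (k - j) Y).const_smul _) t)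
  meas_top := ((continuous_coneHarmonic (k - s) Y).const_smul _).aestronglyMeasurable
  slice_top := .of_forall fun t => memLp_of_continuous_sphere
    (continuous_slice ((continuous_coneHarmonic (k - s) Y).const_smul _) t)
  deriv j _ := isTDeriv_smul_coneHarmonic hY k j

theorem tDeriv_coneHarmonic_rim [NeZero d] (hY : IsSolidHarmonic m Y) (k : ℕ) {j : ℕ}
    (hj : j < s) :
    (fun ξ => tDeriv s (coneHarmonic k Y) j (conePoint 1 ξ)) =ᵐ[sphereMeasure d]
      fun ξ => k.descFactorial j * sphereEval Y ξ := by
  have ae_eq := (isTDerivChain_coneHarmonic hY s k).tDeriv_slice_ae_eq hj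
    (right_mem_Ioc.2 one_pos)
  simpa [coneHarmonic_conePoint hY.1 (right_mem_Ioc.2 one_pos)] using ae_eq

theorem tDeriv_coneHarmonic_top [NeZero d] (hY : IsSolidHarmonic m Y) (k : ℕ) {γ : ℝ} :
    tDeriv s (coneHarmonic k Y) s =ᵐ[weightedConeMeasure d β γ]
      (k.descFactorial s : ℝ) • coneHarmonic (k - s) Y := by
  have ae_eq := (isTDerivChain_coneHarmonic hY s k).tDeriv_top_ae_eq (β := β) (γ := γ)
  simpa using ae_eq

theorem memConeSobolev_coneHarmonic [NeZero d] (hβ : -(d : ℝ) < β + s) (hY : IsSolidHarmonic m Y)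
    (k : ℕ) : MemConeSobolev β s (coneHarmonic k Y) := by
  have := isFiniteMeasure_weightedCone hβ le_rfl
  refine ⟨continuous_coneHarmonic k Y, ⟨_, by simp, isTDerivChain_coneHarmonic hY s k⟩, ?_⟩
  exact (memLp_of_continuous_cone ((continuous_coneHarmonic (k - s) Y).const_smul _)).ae_eq
    (tDeriv_coneHarmonic_top hY k).symm

theorem memConeSobolev_zero [NeZero d] (hβ : -(d : ℝ) < β + s) :
    MemConeSobolev β s (0 : ConeSurface d → ℝ) := by
  have harmonic_zero : IsSolidHarmonic 0 (0 : MvPolynomial (Fin d) ℝ) :=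
    ⟨isHomogeneous_zero _ _ _, by simp⟩
  have coneHarmonic_zero : coneHarmonic 0 (0 : MvPolynomial (Fin d) ℝ) = 0 := by
    funext p
    simp [coneHarmonic]
  exact coneHarmonic_zero ▸ memConeSobolev_coneHarmonic hβ harmonic_zero 0

theorem IsConePoly.memConeSobolev [NeZero d] (hβ : -(d : ℝ) < β + s) {n : ℕ}
    {q : ConeSurface d → ℝ} (hq : IsConePoly n q) : MemConeSobolev β s q := by
  have mem_span := hq.mem_span_coneHarmonics
  clear hq
  induction mem_span using Submodule.span_induction with
  | mem q hq =>
    obtain ⟨k, m, Y, -, hY, rfl⟩ := hq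
    exact memConeSobolev_coneHarmonic hβ hY k
  | zero => exact memConeSobolev_zero hβ
  | add p q _ _ hp hq => simpa using hp.add_smul hq 1 1
  | smul c q _ hq => simpa using hq.add_smul (memConeSobolev_zero hβ) c 0

end HarmonicDerivatives

section Projections

variable {d : ℕ} {E : Set (ConeSurface d → ℝ)}
  {ip : (ConeSurface d → ℝ) → (ConeSurface d → ℝ) → ℝ}

/-- `ip` is symmetric and bilinear on the space `E`, which contains the polynomials on the conic
surface, and is definite on polynomials. This is what the theory of the projections onto the spaces
of orthogonal polynomials needs, for functions in `E`. -/
structure IsPolyInner (E : Set (ConeSurface d → ℝ))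
    (ip : (ConeSurface d → ℝ) → (ConeSurface d → ℝ) → ℝ) : Prop where
  poly_mem : ∀ {n q}, IsConePoly n q → q ∈ E
  comm : ∀ f g, ip f g = ip g f
  add_smul_left : ∀ {f g h}, f ∈ E → g ∈ E → h ∈ E → ∀ a b : ℝ,
    ip (a • f + b • g) h = a * ip f h + b * ip g h
  definite : ∀ {n q}, IsConePoly n q → ip q q = 0 → q = 0

theorem IsConePoly.zero (n : ℕ) : IsConePoly n (0 : ConeSurface d → ℝ) :=
  mem_conePolys.1 (Submodule.zero_mem _)

theorem IsConePoly.add_smul {n : ℕ} {p q : ConeSurface d → ℝ} (hp : IsConePoly n p)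
    (hq : IsConePoly n q) (a b : ℝ) : IsConePoly n (a • p + b • q) := by
  rw [← mem_conePolys] at *
  exact Submodule.add_mem _ (Submodule.smul_mem _ _ hp) (Submodule.smul_mem _ _ hq)

namespace IsPolyInner

variable {n : ℕ} {f p q : ConeSurface d → ℝ}

theorem add_smul_right (hip : IsPolyInner E ip) (hf : f ∈ E) (hp : p ∈ E) (hq : q ∈ E) (a b : ℝ) :
    ip f (a • p + b • q) = a * ip f p + b * ip f q := by
  rw [hip.comm, hip.add_smul_left hp hq hf, hip.comm p, hip.comm q]

theorem zero_left (hip : IsPolyInner E ip) (hf : f ∈ E) : ip 0 f = 0 := by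
  simpa using hip.add_smul_left hf hf hf 0 0

/-- The orthogonal polynomials of degree `n`, as a vector space. -/
def orthSubmodule (hip : IsPolyInner E ip) (n : ℕ) : Submodule ℝ (ConeSurface d → ℝ) where
  carrier := orthPolys ip n
  zero_mem' := ⟨.zero n, fun _ _ _ hr => hip.zero_left (hip.poly_mem hr)⟩
  add_mem' {p q} hp hq := by
    refine ⟨by simpa using hp.1.add_smul hq.1 1 1, fun m hm r hr => ?_⟩
    have := hip.add_smul_left (hip.poly_mem hp.1) (hip.poly_mem hq.1) (hip.poly_mem hr) 1 1
    simpa [hp.2 m hm r hr, hq.2 m hm r hr] using this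
  smul_mem' c p hp := by
    refine ⟨by simpa using hp.1.add_smul hp.1 c 0, fun m hm r hr => ?_⟩
    have := hip.add_smul_left (hip.poly_mem hp.1) (hip.poly_mem hp.1) (hip.poly_mem hr) c 0
    simpa [hp.2 m hm r hr] using this

instance (hip : IsPolyInner E ip) : FiniteDimensional ℝ (hip.orthSubmodule n) :=
  Submodule.finiteDimensional_of_le (S₂ := conePolys d n) fun _ hq => mem_conePolys.2 hq.1

theorem isOrthProj_unique (hip : IsPolyInner E ip)
    (hp : IsOrthProj ip (orthPolys ip n) f p) (hq : IsOrthProj ip (orthPolys ip n) f q) :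
    p = q := by
  have sub_mem : p - q ∈ orthPolys ip n := (hip.orthSubmodule n).sub_mem hp.1 hq.1
  refine sub_eq_zero.1 (hip.definite sub_mem.1 ?_)
  have expand := hip.add_smul_left (hip.poly_mem hp.1.1) (hip.poly_mem hq.1.1)
    (hip.poly_mem sub_mem.1) 1 (-1)
  rw [one_smul, neg_one_smul, ← sub_eq_add_neg, ← hp.2 _ sub_mem, ← hq.2 _ sub_mem] at expand
  rw [expand]
  ring

theorem orthProj_eq (hip : IsPolyInner E ip) (hp : IsOrthProj ip (orthPolys ip n) f p) :
    orthProj ip (orthPolys ip n) f = p := by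
  have exists_proj : ∃ p, IsOrthProj ip (orthPolys ip n) f p := ⟨p, hp⟩
  rw [orthProj, dif_pos exists_proj]
  exact hip.isOrthProj_unique exists_proj.choose_spec hp

/-- The bilinear form `ip` on the finite-dimensional space of orthogonal polynomials of
degree `n`. -/
def orthBilin (hip : IsPolyInner E ip) (n : ℕ) : LinearMap.BilinForm ℝ (hip.orthSubmodule n) :=
  LinearMap.mk₂ ℝ (fun u v => ip u v)
    (fun u v w => by
      simpa using hip.add_smul_left (hip.poly_mem u.2.1) (hip.poly_mem v.2.1)
        (hip.poly_mem w.2.1) 1 1)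
    (fun c u w => by
      simpa using hip.add_smul_left (hip.poly_mem u.2.1) (hip.poly_mem u.2.1)
        (hip.poly_mem w.2.1) c 0)
    (fun u v w => by
      simpa using hip.add_smul_right (hip.poly_mem u.2.1) (hip.poly_mem v.2.1)
        (hip.poly_mem w.2.1) 1 1)
    (fun c u w => by
      simpa using hip.add_smul_right (hip.poly_mem u.2.1) (hip.poly_mem w.2.1)
        (hip.poly_mem w.2.1) c 0)

theorem nondegenerate_orthBilin (hip : IsPolyInner E ip) (n : ℕ) :
    (hip.orthBilin n).Nondegenerate := by
  have separating (u : hip.orthSubmodule n) (hu : ip u u = 0) : u = 0 :=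
    Subtype.ext (hip.definite u.2.1 hu)
  exact ⟨fun u hu => separating u (hu u), fun u hu => separating u (hu u)⟩

theorem exists_isOrthProj (hip : IsPolyInner E ip) (n : ℕ) (hf : f ∈ E) :
    ∃ p, IsOrthProj ip (orthPolys ip n) f p := by
  let pairing : hip.orthSubmodule n →ₗ[ℝ] ℝ :=
    { toFun := fun v => ip f v
      map_add' := fun u v => by
        simpa using hip.add_smul_right hf (hip.poly_mem u.2.1) (hip.poly_mem v.2.1) 1 1
      map_smul' := fun c u => by
        simpa using hip.add_smul_right hf (hip.poly_mem u.2.1) (hip.poly_mem u.2.1) c 0 }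
  let p := ((hip.orthBilin n).toDual (hip.nondegenerate_orthBilin n)).symm pairing
  refine ⟨p, p.2, fun v hv => ?_⟩
  exact (LinearMap.BilinForm.apply_toDual_symm_apply (hB := hip.nondegenerate_orthBilin n)
    pairing ⟨v, hv⟩).symm

theorem existsUnique_isOrthProj (hip : IsPolyInner E ip) (n : ℕ) (hf : f ∈ E) :
    ∃! p, IsOrthProj ip (orthPolys ip n) f p :=
  existsUnique_of_exists_of_unique (hip.exists_isOrthProj n hf) fun _ _ => hip.isOrthProj_unique

end IsPolyInner

section Forms

variable {β γ : ℝ}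

theorem coneNormConst_pos [NeZero d] (hβ : -(d : ℝ) < β) (hγ : 0 ≤ γ) :
    0 < coneNormConst d β γ :=
  mul_pos (one_div_pos.2 sphereArea_pos) (div_pos (Real.Gamma_pos_of_pos (by linarith))
    (mul_pos (Real.Gamma_pos_of_pos (by linarith)) (Real.Gamma_pos_of_pos (by linarith))))

theorem IsConePoly.memLp_weightedCone [NeZero d] (hβ : -(d : ℝ) < β) (hγ : 0 ≤ γ) {n : ℕ}
    {q : ConeSurface d → ℝ} (hq : IsConePoly n q) : MemLp q 2 (weightedConeMeasure d β γ) :=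
  have := isFiniteMeasure_weightedCone hβ hγ
  memLp_of_continuous_cone hq.continuous

theorem isPolyInner_coneInner [NeZero d] (hβ : -(d : ℝ) < β) (hγ : 0 ≤ γ) :
    IsPolyInner {f | MemLp f 2 (weightedConeMeasure d β γ)} (coneInner β γ) where
  poly_mem hq := hq.memLp_weightedCone hβ hγ
  comm f g := by simp only [coneInner, mul_comm]
  add_smul_left {f g h} hf hg hh a b := by
    have expand := integral_add_smul_mul (z := a • f + b • g) (a := a) (b := b) .rfl hf hg hh
    rw [coneInner, expand, coneInner, coneInner]
    ring
  definite hq hqq := by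
    refine eq_zero_of_ae_eq_zero_weightedCone hq.continuous
      (ae_eq_zero_of_integral_mul_self (hq.memLp_weightedCone hβ hγ) ?_)
    exact (mul_eq_zero.1 hqq).resolve_left (coneNormConst_pos hβ hγ).ne'

theorem isPolyInner_coneSobolevInner [NeZero d] {s : ℕ} (hβ : -(d : ℝ) < β + s) {lam : ℕ → ℝ}
    (hlam : ∀ k < s, 0 < lam k) :
    IsPolyInner {f : ConeSurface d → ℝ | MemConeSobolev β s f} (coneSobolevInner β s lam) where
  poly_mem hq := hq.memConeSobolev hβ
  comm := coneSobolevInner_comm β s lam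
  add_smul_left hf hg hh := coneSobolevInner_add_smul lam hf hg hh
  definite hq hqq := eq_zero_of_coneSobolevInner_self hlam (hq.memConeSobolev hβ) hqq

end Forms

end Projections

section Duality

open MvPolynomial Set

variable {d : ℕ}

theorem sq_integral_mul_le {α : Type*} [MeasurableSpace α] {μ : Measure α} {u v : α → ℝ}
    (hu : MemLp u 2 μ) (hv : MemLp v 2 μ) :
    (∫ x, u x * v x ∂μ) ^ 2 ≤ (∫ x, u x ^ 2 ∂μ) * ∫ x, v x ^ 2 ∂μ := by
  have inner_toLp {u v : α → ℝ} (hu : MemLp u 2 μ) (hv : MemLp v 2 μ) :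
      inner ℝ (hu.toLp u) (hv.toLp v) = ∫ x, u x * v x ∂μ := by
    rw [L2.inner_def]
    refine integral_congr_ae ?_
    filter_upwards [hu.coeFn_toLp, hv.coeFn_toLp] with x hux hvx
    rw [hux, hvx, real_inner_eq_re_inner, RCLike.inner_apply, mul_comm]
    rfl
  simpa only [inner_toLp, ← sq] using real_inner_mul_inner_self_le (hu.toLp u) (hv.toLp v)

section HarmonicCoeff

variable {F : ConeSurface d → ℝ} {m : ℕ} {Y : MvPolynomial (Fin d) ℝ} {t : ℝ}

theorem harmonicCoeff_fun_mul (a : ℝ → ℝ) (F : ConeSurface d → ℝ) (m : ℕ)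
    (Y : MvPolynomial (Fin d) ℝ) (ht : t ∈ Ioc 0 1) :
    harmonicCoeff (fun p => a p.1.2 * F p) m Y t = a t * harmonicCoeff F m Y t := by
  simp only [harmonicCoeff_eq, conePoint_val ht.1.le ht.2, mul_assoc, integral_const_mul]
  ring

theorem sq_harmonicCoeff_le
    (hF : MemLp (fun ξ => F (conePoint t ξ)) 2 (sphereMeasure d)) :
    harmonicCoeff F m Y t ^ 2 ≤ ((t ^ m)⁻¹ * (1 / sphereArea d)) ^ 2 *
      ((∫ ξ, F (conePoint t ξ) ^ 2 ∂sphereMeasure d) *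
        ∫ ξ, sphereEval Y ξ ^ 2 ∂sphereMeasure d) := by
  rw [harmonicCoeff_eq, ← mul_assoc, mul_pow]
  gcongr
  exact sq_integral_mul_le hF (memLp_of_continuous_sphere (continuous_sphereEval Y))

theorem tendsto_harmonicCoeff_rim
    (hF : ∀ᶠ t in 𝓝[<] (1 : ℝ), MemLp (fun ξ => F (conePoint t ξ)) 2 (sphereMeasure d))
    (hlim : Tendsto (fun t => ∫ ξ, F (conePoint t ξ) ^ 2 ∂sphereMeasure d) (𝓝[<] 1) (𝓝 0)) :
    Tendsto (harmonicCoeff F m Y) (𝓝[<] 1) (𝓝 0) := by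
  set J := ∫ ξ, sphereEval Y ξ ^ 2 ∂sphereMeasure d
  have tendsto_bound : Tendsto (fun t : ℝ => ((t ^ m)⁻¹ * (1 / sphereArea d)) ^ 2 *
      ((∫ ξ, F (conePoint t ξ) ^ 2 ∂sphereMeasure d) * J)) (𝓝[<] 1)
      (𝓝 ((((1 : ℝ) ^ m)⁻¹ * (1 / sphereArea d)) ^ 2 * (0 * J))) := by
    refine Tendsto.mul (Tendsto.mono_left ?_ nhdsWithin_le_nhds) (hlim.mul_const J)
    exact (((tendsto_id.pow m).inv₀ (by simp)).mul_const _).pow 2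
  rw [zero_mul, mul_zero] at tendsto_bound
  have tendsto_sq : Tendsto (fun t => harmonicCoeff F m Y t ^ 2) (𝓝[<] 1) (𝓝 0) :=
    squeeze_zero' (.of_forall fun t => sq_nonneg _) (hF.mono fun t => sq_harmonicCoeff_le)
      tendsto_bound
  refine (tendsto_zero_iff_abs_tendsto_zero _).2 ?_
  simpa [Function.comp_def, Real.sqrt_sq_eq_abs] using tendsto_sq.sqrt

end HarmonicCoeff

/-- The pairs `f = (1 - t) ^ s * g` of the theorem: `f` lies in the Sobolev space, `g` is square
integrable, and `f` vanishes to order `s` at the rim `t = 1`. -/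
structure IsRimPair (β : ℝ) (s : ℕ) (f g : ConeSurface d → ℝ) : Prop where
  sobolev : MemConeSobolev β s f
  memLp : MemLp g 2 (weightedConeMeasure d β s)
  eq_mul : ∀ p : ConeSurface d, f p = (1 - p.1.2) ^ s * g p
  rim : Tendsto (fun t => ∫ ξ, ((1 - t) * g (conePoint t ξ)) ^ 2 ∂sphereMeasure d)
    (𝓝[<] 1) (𝓝 0)

theorem IsConePoly.isRimPair [NeZero d] {β : ℝ} (hβ : -(d : ℝ) < β) (s : ℕ) {n : ℕ}
    {q : ConeSurface d → ℝ} (hq : IsConePoly n q) :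
    IsRimPair β s (fun p => (1 - p.1.2) ^ s * q p) q where
  sobolev := (hq.one_sub_pow_mul s).memConeSobolev (lt_add_of_lt_of_nonneg hβ s.cast_nonneg)
  memLp := hq.memLp_weightedCone hβ s.cast_nonneg
  eq_mul _ := rfl
  rim := by
    have continuous_integrand :
        Continuous fun x : ℝ × UnitSphere d => ((1 - x.1) * q (conePoint x.1 x.2)) ^ 2 :=
      ((continuous_const.sub continuous_fst).mul
        (hq.continuous.comp (continuous_conePoint d))).pow 2
    have continuous_integral := continuous_parametric_integral_of_continuous
      (μ := sphereMeasure d) (f := fun t ξ => ((1 - t) * q (conePoint t ξ)) ^ 2)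
      continuous_integrand isCompact_univ
    simpa using (continuous_integral.tendsto 1).mono_left nhdsWithin_le_nhds

namespace IsRimPair

variable {β : ℝ} {s : ℕ} {f g : ConeSurface d → ℝ}

theorem harmonicCoeff_eq_mul (h : IsRimPair β s f g) (m : ℕ) (Y : MvPolynomial (Fin d) ℝ) {t : ℝ}
    (ht : t ∈ Ioc 0 1) : harmonicCoeff f m Y t = (1 - t) ^ s * harmonicCoeff g m Y t := by
  rw [funext h.eq_mul]
  exact harmonicCoeff_fun_mul (fun t => (1 - t) ^ s) g m Y ht

theorem tendsto_harmonicCoeff_div (h : IsRimPair β s f g) (hs : 0 < s) (m : ℕ)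
    (Y : MvPolynomial (Fin d) ℝ) :
    Tendsto (fun t => harmonicCoeff f m Y t / (1 - t) ^ (s - 1)) (𝓝[<] 1) (𝓝 0) := by
  let F : ConeSurface d → ℝ := fun p => (1 - p.1.2) * g p
  have slice {t : ℝ} (ht : t ∈ Ioo 0 1) (ξ : UnitSphere d) :
      F (conePoint t ξ) = (1 - t) * g (conePoint t ξ) := by
    simp only [F, conePoint_val ht.1.le ht.2.le]
  have pow_split (t : ℝ) : (1 - t) ^ s = (1 - t) ^ (s - 1) * (1 - t) := by
    rw [← pow_succ, Nat.sub_add_cancel hs]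
  have slice_eq_div {t : ℝ} (ht : t ∈ Ioo 0 1) (ξ : UnitSphere d) :
      F (conePoint t ξ) = f (conePoint t ξ) / (1 - t) ^ (s - 1) := by
    rw [slice ht, h.eq_mul, conePoint_val ht.1.le ht.2.le,
      eq_div_iff (pow_ne_zero _ (sub_pos.2 ht.2).ne'), pow_split]
    ring
  have tendsto_F : Tendsto (harmonicCoeff F m Y) (𝓝[<] 1) (𝓝 0) := by
    refine tendsto_harmonicCoeff_rim ?_ (h.rim.congr' ?_) <;>
      filter_upwards [eventually_mem_Ioo_nhdsLT_one] with t ht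
    · simp only [slice_eq_div ht]
      exact memLp_of_continuous_sphere ((continuous_slice h.sobolev.1 t).div_const _)
    · simp only [slice ht]
  refine tendsto_F.congr' ?_
  filter_upwards [eventually_mem_Ioo_nhdsLT_one] with t ht
  simp only [harmonicCoeff_eq, slice_eq_div ht, div_mul_eq_mul_div, integral_div]
  ring

theorem harmonicCoeff_tDeriv_rim (h : IsRimPair β s f g) {m : ℕ} {Y : MvPolynomial (Fin d) ℝ}
    (hY : IsSolidHarmonic m Y) {k : ℕ} (hk : k < s) : harmonicCoeff (tDeriv s f k) m Y 1 = 0 := by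
  obtain ⟨tDeriv_zero, chain⟩ := h.sobolev.2.1.tDeriv_spec
  refine (chain.isACChain hY).eq_zero_of_rim ?_ hk
  rw [tDeriv_zero]
  exact h.tendsto_harmonicCoeff_div (by lia) m Y

end IsRimPair

theorem radialWeight_mul_pow [NeZero d] (β γ : ℝ) (i m : ℕ) {t : ℝ} (ht : 0 < t) :
    radialWeight d β γ t * (t ^ (i + m) * t ^ m) =
      t ^ (β + (d - 1) + i + 2 * m) * (1 - t) ^ γ := by
  have exponent : β + (d - 1) + i + 2 * m = β + (d - 1 : ℕ) + (i + m : ℕ) + m := by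
    rw [Nat.cast_pred (NeZero.pos d)]
    push_cast
    ring
  rw [exponent, Real.rpow_add_natCast ht.ne', Real.rpow_add_natCast ht.ne',
    Real.rpow_add_natCast ht.ne', radialWeight]
  ring

theorem integral_mul_coneHarmonic [NeZero d] {β γ : ℝ} {F : ConeSurface d → ℝ} {i m : ℕ}
    {Y : MvPolynomial (Fin d) ℝ} (hY : Y.IsHomogeneous m)
    (hF : Integrable (fun p => F p * coneHarmonic i Y p) (weightedConeMeasure d β γ)) :
    IntegrableOn (fun t => harmonicCoeff F m Y t * (t ^ (β + (d - 1) + i + 2 * m) * (1 - t) ^ γ))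
      (Ioc 0 1) ∧
    ∫ p, F p * coneHarmonic i Y p ∂weightedConeMeasure d β γ = sphereArea d *
      ∫ t in Ioc 0 1, harmonicCoeff F m Y t *
        (t ^ (β + (d - 1) + i + 2 * m) * (1 - t) ^ γ) := by
  have area_ne_zero := (sphereArea_pos (d := d)).ne'
  have slice : ∀ t ∈ Ioc (0 : ℝ) 1, radialWeight d β γ t *
      ∫ ξ, F (conePoint t ξ) * coneHarmonic i Y (conePoint t ξ) ∂sphereMeasure d =
      sphereArea d * (harmonicCoeff F m Y t *
        (t ^ (β + (d - 1) + i + 2 * m) * (1 - t) ^ γ)) := by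
    intro t ht
    simp only [coneHarmonic_conePoint hY ht, mul_left_comm _ (t ^ (i + m))]
    rw [integral_const_mul, integral_slice_mul_sphereEval F m Y ht.1,
      ← radialWeight_mul_pow β γ i m ht.1]
    ring
  obtain ⟨integrable, integral_eq⟩ := integral_weightedCone hF
  rw [integrableOn_congr_fun slice measurableSet_Ioc] at integrable
  constructor
  · simpa only [IntegrableOn, inv_mul_cancel_left₀ area_ne_zero] using
      integrable.const_mul (sphereArea d)⁻¹
  · rw [integral_eq, setIntegral_congr_fun measurableSet_Ioc slice, integral_const_mul]

namespace IsRimPair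

variable [NeZero d] {β : ℝ} {s : ℕ} {f g : ConeSurface d → ℝ} {m : ℕ}
  {Y : MvPolynomial (Fin d) ℝ}

theorem integral_mul_coneHarmonic_eq_integral_tDeriv (h : IsRimPair β s f g) (hβ : -(d : ℝ) < β)
    (hY : IsSolidHarmonic m Y) (i : ℕ) :
    ∫ p, g p * coneHarmonic i Y p ∂weightedConeMeasure d β s =
      (∏ j ∈ Finset.range s, -(β + (d - 1) + i + 2 * m + j + 1)⁻¹) *
        ∫ p, tDeriv s f s p * coneHarmonic i Y p ∂weightedConeMeasure d (β + s) 0 := by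
  obtain ⟨tDeriv_zero, chain⟩ := h.sobolev.2.1.tDeriv_spec
  have poly : IsConePoly (i + m) (coneHarmonic i Y) :=
    isConePoly_coneHarmonic i hY.1.totalDegree_le
  obtain ⟨top_integrable, top_integral⟩ := integral_mul_coneHarmonic hY.1
    (integrable_fun_mul_of_memLp h.sobolev.2.2
      (poly.memLp_weightedCone (lt_add_of_lt_of_nonneg hβ s.cast_nonneg) le_rfl))
  obtain ⟨-, integral_g⟩ := integral_mul_coneHarmonic hY.1
    (integrable_fun_mul_of_memLp h.memLp (poly.memLp_weightedCone hβ s.cast_nonneg))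
  set r : ℝ := β + (d - 1) + i + 2 * m
  have hr : -1 < r := by
    simp only [r]
    linarith [i.cast_nonneg (α := ℝ), m.cast_nonneg (α := ℝ)]
  have exponent : β + s + (d - 1) + i + 2 * m = r + s := by ring
  simp only [Real.rpow_zero, mul_one, exponent] at top_integrable top_integral
  obtain ⟨-, by_parts⟩ := (chain.isACChain hY).integral_mul_rpow
    (fun _ => h.harmonicCoeff_tDeriv_rim hY) hr top_integrable
  have coeff_g : ∫ t in Ioc 0 1, harmonicCoeff g m Y t * (t ^ r * (1 - t) ^ (s : ℝ)) =
      ∫ t in Ioc 0 1, harmonicCoeff (tDeriv s f 0) m Y t * t ^ r := by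
    refine setIntegral_congr_fun measurableSet_Ioc fun t ht => ?_
    rw [tDeriv_zero, h.harmonicCoeff_eq_mul m Y ht, Real.rpow_natCast]
    ring
  rw [integral_g, coeff_g, by_parts, top_integral]
  ring

theorem coneSobolevInner_coneHarmonic (h : IsRimPair β s f g) (lam : ℕ → ℝ)
    (hY : IsSolidHarmonic m Y) (k : ℕ) :
    coneSobolevInner β s lam f (coneHarmonic k Y) =
      1 / sphereArea d * (k.descFactorial s *
        ∫ p, tDeriv s f s p * coneHarmonic (k - s) Y p ∂weightedConeMeasure d (β + s) 0) := by
  rw [coneSobolevInner, Finset.sum_eq_zero, add_zero]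
  · congr 1
    rw [← integral_const_mul]
    refine integral_congr_ae ?_
    filter_upwards [tDeriv_coneHarmonic_top hY k] with p hp
    rw [hp, Pi.smul_apply, smul_eq_mul]
    ring
  · intro j hj
    have hj := Finset.mem_range.1 hj
    have rim_eq : ∫ ξ, tDeriv s f j (conePoint 1 ξ) *
        tDeriv s (coneHarmonic k Y) j (conePoint 1 ξ) ∂sphereMeasure d =
        ∫ ξ, k.descFactorial j * (tDeriv s f j (conePoint 1 ξ) * sphereEval Y ξ)
          ∂sphereMeasure d := by
      refine integral_congr_ae ?_
      filter_upwards [tDeriv_coneHarmonic_rim hY k hj] with ξ hξ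
      rw [hξ]
      ring
    rw [rim_eq, integral_const_mul, integral_slice_mul_sphereEval _ m Y one_pos,
      h.harmonicCoeff_tDeriv_rim hY hj]
    simp only [mul_zero]

end IsRimPair

variable {β : ℝ} {s : ℕ} {lam : ℕ → ℝ} {n : ℕ}

/-- The polynomial `v` of degree at most `n` acts on `f = (1 - t) ^ s * g` through the Sobolev
inner product as the polynomial `w` of degree at most `n - s` acts on `g` through the inner product
of the weight `w_{β,s}`. For `n < s`, where `n - s` is `0` in `ℕ`, this asks for `w = 0`. -/
structure IsDualPoly (β : ℝ) (s : ℕ) (lam : ℕ → ℝ) (n : ℕ) (v w : ConeSurface d → ℝ) : Prop where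
  left_isConePoly : IsConePoly n v
  right_isConePoly : IsConePoly (n - s) w
  right_eq_zero : n < s → w = 0
  inner_eq : ∀ {f g}, IsRimPair β s f g → coneSobolevInner β s lam f v = coneInner β s g w

variable [NeZero d]

theorem IsDualPoly.add_smul {u v w z : ConeSurface d → ℝ} (hβ : -(d : ℝ) < β)
    (hu : IsDualPoly β s lam n u w) (hv : IsDualPoly β s lam n v z) (a b : ℝ) :
    IsDualPoly β s lam n (a • u + b • v) (a • w + b • z) where
  left_isConePoly := hu.left_isConePoly.add_smul hv.left_isConePoly a b
  right_isConePoly := hu.right_isConePoly.add_smul hv.right_isConePoly a b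
  right_eq_zero hn := by
    rw [hu.right_eq_zero hn, hv.right_eq_zero hn, smul_zero, smul_zero, add_zero]
  inner_eq {f g} hfg := by
    have hβs := lt_add_of_lt_of_nonneg hβ (s.cast_nonneg (α := ℝ))
    have hγ := s.cast_nonneg (α := ℝ)
    rw [coneSobolevInner_comm, coneSobolevInner_add_smul lam
      (hu.left_isConePoly.memConeSobolev hβs) (hv.left_isConePoly.memConeSobolev hβs) hfg.sobolev,
      coneSobolevInner_comm β s lam u, coneSobolevInner_comm β s lam v, hu.inner_eq hfg,
      hv.inner_eq hfg]
    exact ((isPolyInner_coneInner hβ hγ).add_smul_right hfg.memLp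
      (hu.right_isConePoly.memLp_weightedCone hβ hγ)
      (hv.right_isConePoly.memLp_weightedCone hβ hγ) a b).symm

section ConeHarmonic

variable {k m : ℕ} {Y : MvPolynomial (Fin d) ℝ}

theorem isDualPoly_coneHarmonic_zero (hY : IsSolidHarmonic m Y) (hkm : k + m ≤ n) (hk : k < s) :
    IsDualPoly β s lam n (coneHarmonic k Y) 0 where
  left_isConePoly := (isConePoly_coneHarmonic k hY.1.totalDegree_le).mono hkm
  right_isConePoly := .zero _
  right_eq_zero _ := rfl
  inner_eq hfg := by
    rw [hfg.coneSobolevInner_coneHarmonic lam hY, Nat.descFactorial_of_lt hk]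
    simp [coneInner]

theorem isDualPoly_coneHarmonic (hβ : -(d : ℝ) < β) (hY : IsSolidHarmonic m Y) (hkm : k + m ≤ n)
    (hk : s ≤ k) : ∃ a : ℝ,
    IsDualPoly β s lam n (coneHarmonic k Y) (a • coneHarmonic (k - s) Y) := by
  have area_ne_zero := (sphereArea_pos (d := d)).ne'
  have const_ne_zero := (coneNormConst_pos hβ (s.cast_nonneg (α := ℝ))).ne'
  set c : ℝ := ∏ j ∈ Finset.range s, -(β + (d - 1) + (k - s : ℕ) + 2 * m + j + 1)⁻¹ with hc
  have c_ne_zero : c ≠ 0 := by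
    refine Finset.prod_ne_zero_iff.2 fun j _ => neg_ne_zero.2 (inv_ne_zero ?_)
    have := (k - s).cast_nonneg (α := ℝ)
    have := m.cast_nonneg (α := ℝ)
    have := j.cast_nonneg (α := ℝ)
    exact (by linarith : 0 < β + (d - 1) + (k - s : ℕ) + 2 * m + j + 1).ne'
  have poly := isConePoly_coneHarmonic (k - s) hY.1.totalDegree_le
  refine ⟨k.descFactorial s / (c * (coneNormConst d β s * sphereArea d)),
    (isConePoly_coneHarmonic k hY.1.totalDegree_le).mono hkm, ?_, by lia, fun {f g} hfg => ?_⟩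
  · simpa using (poly.mono (by lia : k - s + m ≤ n - s)).add_smul (.zero _) _ 0
  · rw [hfg.coneSobolevInner_coneHarmonic lam hY, coneInner]
    simp only [Pi.smul_apply, smul_eq_mul, mul_left_comm (g _), integral_const_mul,
      hfg.integral_mul_coneHarmonic_eq_integral_tDeriv hβ hY, ← hc]
    field_simp

end ConeHarmonic

theorem IsConePoly.exists_isDualPoly (hβ : -(d : ℝ) < β) (s : ℕ) (lam : ℕ → ℝ)
    {v : ConeSurface d → ℝ} (hv : IsConePoly n v) : ∃ w, IsDualPoly β s lam n v w := by
  have mem_span := hv.mem_span_coneHarmonics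
  clear hv
  induction mem_span using Submodule.span_induction with
  | mem v hv =>
    obtain ⟨k, m, Y, hkm, hY, rfl⟩ := hv
    rcases lt_or_ge k s with hk | hk
    · exact ⟨0, isDualPoly_coneHarmonic_zero hY hkm hk⟩
    · obtain ⟨a, ha⟩ := isDualPoly_coneHarmonic hβ hY hkm hk
      exact ⟨_, ha⟩
  | zero =>
    refine ⟨0, .zero n, .zero _, fun _ => rfl, fun hfg => ?_⟩
    have zero_mem := memConeSobolev_zero (d := d) (lt_add_of_lt_of_nonneg hβ s.cast_nonneg)
    rw [coneSobolevInner_comm]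
    simpa [coneInner] using coneSobolevInner_add_smul lam zero_mem zero_mem hfg.sobolev 0 0
  | add u v _ _ ihu ihv =>
    obtain ⟨w, hw⟩ := ihu
    obtain ⟨z, hz⟩ := ihv
    exact ⟨_, by simpa using hw.add_smul hβ hz 1 1⟩
  | smul c u _ ihu =>
    obtain ⟨w, hw⟩ := ihu
    exact ⟨_, by simpa using hw.add_smul hβ hw c 0⟩

end Duality

section SobolevProjections

variable {d : ℕ} [NeZero d] {β : ℝ} {s : ℕ} {f g : ConeSurface d → ℝ} {n : ℕ}

namespace IsRimPair

theorem coneSobolevInner_eq_zero (h : IsRimPair β s f g) (hβ : -(d : ℝ) < β) (lam : ℕ → ℝ)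
    (hn : n < s) {v : ConeSurface d → ℝ} (hv : IsConePoly n v) :
    coneSobolevInner β s lam f v = 0 := by
  obtain ⟨w, dual⟩ := hv.exists_isDualPoly hβ s lam
  rw [dual.inner_eq h, dual.right_eq_zero hn]
  simp [coneInner]

theorem isOrthProj_zero (h : IsRimPair β s f g) (hβ : -(d : ℝ) < β) (lam : ℕ → ℝ) (hn : n < s) :
    IsOrthProj (coneSobolevInner β s lam) (coneSobolevV d β s lam n) f 0 := by
  have zero_pair : IsRimPair β s (0 : ConeSurface d → ℝ) 0 := by
    convert (IsConePoly.zero (d := d) 0).isRimPair hβ s using 1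
    simp [funext_iff]
  refine ⟨⟨.zero n, fun m hm r hr => ?_⟩, fun v hv => ?_⟩
  · exact zero_pair.coneSobolevInner_eq_zero hβ lam (hm.trans hn) hr
  · rw [h.coneSobolevInner_eq_zero hβ lam hn hv.1,
      zero_pair.coneSobolevInner_eq_zero hβ lam hn hv.1]

theorem isOrthProj_one_sub_pow_mul (h : IsRimPair β s f g) (hβ : -(d : ℝ) < β) (lam : ℕ → ℝ)
    (hn : s ≤ n) {q : ConeSurface d → ℝ}
    (hq : IsOrthProj (coneInner β s) (coneV d β s (n - s)) g q) :
    IsOrthProj (coneSobolevInner β s lam) (coneSobolevV d β s lam n) f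
      (fun p => (1 - p.1.2) ^ s * q p) := by
  obtain ⟨⟨q_poly, q_orth⟩, q_proj⟩ := hq
  have q_pair := q_poly.isRimPair hβ s
  refine ⟨⟨?_, fun m hm r hr => ?_⟩, fun v ⟨v_poly, v_orth⟩ => ?_⟩
  · simpa only [Nat.sub_add_cancel hn] using q_poly.one_sub_pow_mul s
  · rcases lt_or_ge m s with hms | hms
    · exact q_pair.coneSobolevInner_eq_zero hβ lam hms hr
    · obtain ⟨w, dual⟩ := hr.exists_isDualPoly hβ s lam
      rw [dual.inner_eq q_pair]
      exact q_orth (m - s) (by lia) w dual.right_isConePoly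
  · obtain ⟨w, dual⟩ := v_poly.exists_isDualPoly hβ s lam
    have w_mem : w ∈ coneV d β s (n - s) := by
      refine ⟨dual.right_isConePoly, fun m hm r hr => ?_⟩
      rw [(isPolyInner_coneInner hβ s.cast_nonneg).comm, ← dual.inner_eq (hr.isRimPair hβ s),
        coneSobolevInner_comm]
      exact v_orth (m + s) (by lia) _ (hr.one_sub_pow_mul s)
    rw [dual.inner_eq h, dual.inner_eq q_pair, q_proj w w_mem]

end IsRimPair

end SobolevProjections

end

theorem mainTheorem7 (d : ℕ) (hd : 1 ≤ d) (s : ℕ) (hs : 1 ≤ s) (β : ℝ) (hβ : -(d : ℝ) < β)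
    (lam : ℕ → ℝ) (hlam : ∀ k < s, 0 < lam k)
    (f g : ConeSurface d → ℝ)
    (hf : MemConeSobolev β s f)
    (hg : MemLp g 2 (weightedConeMeasure d β s))
    (hfg : ∀ p : ConeSurface d, f p = (1 - p.1.2) ^ s * g p)
    (hrim : Tendsto
      (fun t : ℝ => ∫ ξ : UnitSphere d, ((1 - t) * g (conePoint t ξ)) ^ 2 ∂(sphereMeasure d))
      (𝓝[<] 1) (𝓝 0)) :
    ∀ n : ℕ,
      (∃! q, IsOrthProj (coneSobolevInner β s lam) (coneSobolevV d β s lam n) f q) ∧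
      (∃! q, IsOrthProj (coneInner β s) (coneV d β s n) g q) ∧
      (s ≤ n → ∀ p : ConeSurface d,
        coneSobolevProj β s lam n f p = (1 - p.1.2) ^ s * coneProj β s (n - s) g p) ∧
      (n < s → ∀ p : ConeSurface d, coneSobolevProj β s lam n f p = 0) := by
  have : NeZero d := ⟨by lia⟩
  have pair : IsRimPair β s f g := ⟨hf, hg, hfg, hrim⟩
  have weighted := isPolyInner_coneInner hβ (s.cast_nonneg (α := ℝ))
  have sobolev := isPolyInner_coneSobolevInner
    (lt_add_of_lt_of_nonneg hβ (s.cast_nonneg (α := ℝ))) hlam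
  refine fun n => ⟨sobolev.existsUnique_isOrthProj n hf, weighted.existsUnique_isOrthProj n hg,
    fun hn => ?_, fun hn => congr_fun (sobolev.orthProj_eq (pair.isOrthProj_zero hβ lam hn))⟩
  obtain ⟨q, hq⟩ := weighted.exists_isOrthProj (n - s) hg
  have proj_eq : coneProj β s (n - s) g = q := weighted.orthProj_eq hq
  rw [proj_eq]
  exact congr_fun (sobolev.orthProj_eq (pair.isOrthProj_one_sub_pow_mul hβ lam hn hq))
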